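/- Let $n\ge 1$, let $K\subset\mathbb{R}^n$ be a convex body (a compact convex set with nonempty interior), let $U\supset K$ be open, and let $\varphi:U\to(0,\infty)$ be continuous and Lebesgue integrable; extend $\varphi$ to $\mathbb{R}^n$ by $\varphi=0$ outside $U$. Put $\operatorname{vol}_n^\varphi(A)=\int_{A\cap U}\varphi\,d\lambda_n$ for measurable $A\subset\mathbb{R}^n$, where $\lambda_n$ is Lebesgue measure, and $$V_K^\varphi(z)=\operatorname{vol}_n^\varphi([z,K]\setminus K),\qquad z\in\mathbb{R}^n,$$ where $[z,K]$ is the convex hull of $\{z\}\cup K$. Let $n_K(x)$ be the outer unit normal of $K$ at $x\in\partial K$, which is uniquely determined for $\mathcal{H}^{n-1}$-almost all $x\in\partial K$. Here $\mathcal{H}^{n-1}$ is the $(n-1)$-dimensional Hausdorff measure, normalized to agree with Lebesgue measure on $\mathbb{R}^{n-1}$. Then for every $z\in\mathbb{R}^n$ $$V_K^\varphi(z)=-\frac12\operatorname{vol}_n^\varphi(K)+\frac12\int_{\partial K}|(z-x)\cdot n_K(x)|\left(\int_0^1\varphi\big((1-s)z+sx\big)\,s^{n-1}\,ds\right)d\mathcal{H}^{n-1}(x).$$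 Here the inner integral is finite for $\mathcal{H}^{n-1}$-almost all $x\in\partial K$ with $(z-x)\cdot n_K(x)\neq 0$, and the integrand of the outer integral, read as $0$ where $(z-x)\cdot n_K(x)=0$, is integrable over $\partial K$. In particular, $V_K^\varphi$ is continuous on $\mathbb{R}^n$. -/

import Mathlib

open MeasureTheory Set
open scoped InnerProductSpace

/-- `u` is an outer unit normal vector of the convex set `K` at the point `x`. -/
def IsOuterUnitNormal {n : ℕ} (K : Set (EuclideanSpace ℝ (Fin n)))
    (x u : EuclideanSpace ℝ (Fin n)) : Prop :=
  ‖u‖ = 1 ∧ ∀ y ∈ K, ⟪y - x, u⟫_ℝ ≤ 0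

open Classical in
/-- The outer unit normal `n_K(x)` of `K` at `x`: the unique outer unit normal vector at `x` if
there is exactly one. At the remaining boundary points, an `(n-1)`-dimensional null set for a
convex body, the normal is undefined and the value is set to `0`. -/
noncomputable def outerNormal {n : ℕ} (K : Set (EuclideanSpace ℝ (Fin n)))
    (x : EuclideanSpace ℝ (Fin n)) : EuclideanSpace ℝ (Fin n) :=
  if h : ∃! u, IsOuterUnitNormal K x u then h.choose else 0

/-- The weighted volume `vol^φ(A) = ∫_{A ∩ U} φ dλ`, as a measure on `ℝⁿ`. -/
noncomputable def weightedVolume {n : ℕ} (U : Set (EuclideanSpace ℝ (Fin n)))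
    (φ : EuclideanSpace ℝ (Fin n) → ℝ) : Measure (EuclideanSpace ℝ (Fin n)) :=
  (volume.restrict U).withDensity fun y => ENNReal.ofReal (φ y)

/-- The weighted volume of an integrable weight is a finite measure, so that passing to real
values below loses nothing. -/
theorem isFiniteMeasure_weightedVolume {n : ℕ} {U : Set (EuclideanSpace ℝ (Fin n))}
    {φ : EuclideanSpace ℝ (Fin n) → ℝ} (h : IntegrableOn φ U) :
    IsFiniteMeasure (weightedVolume U φ) :=
  isFiniteMeasure_withDensity_ofReal h.2

/-- `V_K^φ(z) = vol^φ([z, K] \ K)`, where `[z, K]` is the convex hull of `{z} ∪ K`. -/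
noncomputable def illuminationFunctional {n : ℕ} (U : Set (EuclideanSpace ℝ (Fin n)))
    (φ : EuclideanSpace ℝ (Fin n) → ℝ) (K : Set (EuclideanSpace ℝ (Fin n)))
    (z : EuclideanSpace ℝ (Fin n)) : ℝ :=
  (weightedVolume U φ).real (convexHull ℝ (insert z K) \ K)

/-- `∫₀¹ φ((1 - s) z + s x) s^{n-1} ds`, where `φ` is extended by `0` outside `U`. -/
noncomputable def segmentIntegral {n : ℕ} (U : Set (EuclideanSpace ℝ (Fin n)))
    (φ : EuclideanSpace ℝ (Fin n) → ℝ) (z x : EuclideanSpace ℝ (Fin n)) : ℝ :=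
  ∫ s in (0 : ℝ)..1, U.indicator φ ((1 - s) • z + s • x) * s ^ (n - 1)

open scoped NNReal ENNReal Topology
open Measure Filter

/-! Split the boundary points `x` with a unique normal by the sign of `(x - z) · n_K(x)`. Up to null
sets, the segments from `z` to points of positive sign, where rays from `z` leave `K`, sweep out
`[z, K]` once; those to points of negative sign, where rays enter `K`, sweep out `[z, K] \ K` once.
The map `(x, s) ↦ (1 - s) z + s x` has Jacobian `|(z - x) · n_K(x)| s^(n-1)`. So the boundary
integral equals `∫_[z,K] φ + ∫_([z,K] \ K) φ = vol K + 2 V_K(z)`, which is the claimed formula.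

The change of variables (`volume_image_conePoint`, `map_conePoint_prod`) is obtained by hand. Near a
smooth boundary point, projecting the base to the tangent hyperplane changes distances in the cone
by a factor at most `a`, for any given `a > 1`; cones with flat base are computed by slicing, and
`a` tends to `1` after summing over countably many pieces.

The sweeping statements (`image_conePoint_ae_eq_convexHull` and
`image_conePoint_ae_eq_convexHull_diff`) miss only rays through tangential or non-smooth points.
There a support function has two maximizers, hence is not differentiable, and Rademacher's theorem
makes these rays null.

Continuity follows by dominated convergence, since the boundary of the convex set `[z₀, K]` is null.
-/

theorem euclideanHausdorffMeasure_image_le_of_dist_le {ι X Y : Type*}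
    [MetricSpace X] [MeasurableSpace X] [BorelSpace X]
    [MetricSpace Y] [MeasurableSpace Y] [BorelSpace Y] (d : ℕ) {a : ι → X} {b : ι → Y}
    {W : Set ι} {c : ℝ≥0}
    (h : ∀ i ∈ W, ∀ j ∈ W, dist (a i) (a j) ≤ c * dist (b i) (b j)) :
    (μHE[d] : Measure X) (a '' W) ≤ (c : ℝ≥0∞) ^ d * (μHE[d] : Measure Y) (b '' W) := by
  classical
  rcases W.eq_empty_or_nonempty with rfl | ⟨i₀, hi₀⟩
  · simp
  have : Nonempty ι := ⟨i₀⟩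
  set g : Y → ι := Function.invFunOn b W
  have hg : ∀ y ∈ b '' W, g y ∈ W ∧ b (g y) = y := fun y hy => ⟨Function.invFunOn_mem hy,
    Function.invFunOn_eq hy⟩
  -- The hypothesis makes `a` constant on the fibres of `b`, so `b i ↦ a i` is a well-defined
  -- `c`-Lipschitz map, whichever preimage `g` selects.
  have hL : LipschitzOnWith c (a ∘ g) (b '' W) := by
    refine LipschitzOnWith.of_dist_le_mul fun y hy y' hy' => ?_
    have := h _ (hg y hy).1 _ (hg y' hy').1
    rwa [(hg y hy).2, (hg y' hy').2] at this
  have himg : a '' W = (a ∘ g) '' (b '' W) := by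
    rw [image_image]
    refine image_congr fun i hi => ?_
    have hb := hg (b i) (mem_image_of_mem b hi)
    have := h _ hb.1 _ hi
    rw [hb.2, dist_self, mul_zero] at this
    exact (dist_le_zero.1 this).symm
  rw [himg, euclideanHausdorffMeasure_def, euclideanHausdorffMeasure_def, Measure.smul_apply,
    Measure.smul_apply, mul_smul_comm]
  have := hL.hausdorffMeasure_image_le (d := d) (by positivity)
  rw [ENNReal.rpow_natCast] at this
  gcongr

/-! ### Non-uniqueness of maximizers is a null event. -/

section RademacherNull

variable {V : Type*} [NormedAddCommGroup V] [InnerProductSpace ℝ V] [FiniteDimensional ℝ V]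
  [MeasurableSpace V] [BorelSpace V]

/-- The support function of a bounded set has a unique maximizer at almost every point. -/
theorem measure_setOf_two_maximizers_eq_zero {L : Set V} {m : ℝ≥0} (hL : ∀ w ∈ L, ‖w‖ ≤ m) :
    volume {y : V | ∃ w₁ ∈ L, ∃ w₂ ∈ L, w₁ ≠ w₂ ∧ (∀ w ∈ L, ⟪y, w⟫_ℝ ≤ ⟪y, w₁⟫_ℝ) ∧
      ∀ w ∈ L, ⟪y, w⟫_ℝ ≤ ⟪y, w₂⟫_ℝ} = 0 := by
  rcases L.eq_empty_or_nonempty with rfl | ⟨w₀, hw₀⟩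
  · simp
  have : Nonempty L := ⟨⟨w₀, hw₀⟩⟩
  set g : V → ℝ := fun y => ⨆ w : L, ⟪y, (w : V)⟫_ℝ
  have hbdd : ∀ y, BddAbove (range fun w : L => ⟪y, (w : V)⟫_ℝ) := by
    rintro y
    refine ⟨‖y‖ * m, ?_⟩
    rintro _ ⟨w, rfl⟩
    exact (real_inner_le_norm _ _).trans (by gcongr; exact hL w w.2)
  have hlip : LipschitzWith m g := by
    refine LipschitzWith.of_le_add_mul m fun x y => ciSup_le fun w => ?_
    have h1 : ⟪x, (w : V)⟫_ℝ = ⟪y, (w : V)⟫_ℝ + ⟪x - y, (w : V)⟫_ℝ := by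
      rw [inner_sub_left]; ring
    rw [h1]
    refine add_le_add (le_ciSup (hbdd y) w) ?_
    refine (real_inner_le_norm _ _).trans ?_
    rw [dist_eq_norm, mul_comm]
    gcongr
    exact hL w w.2
  -- At a maximizer `w₁` the function `g - ⟪·, w₁⟫` attains its minimum at `y`, so the gradient of
  -- `g` must be `w₁`.
  have hderiv : ∀ y, DifferentiableAt ℝ g y → ∀ w₁ ∈ L, (∀ w ∈ L, ⟪y, w⟫_ℝ ≤ ⟪y, w₁⟫_ℝ) →
      fderiv ℝ g y = innerSL ℝ w₁ := by
    intro y hy w₁ hw₁ hmax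
    have hmin : IsLocalMin (fun x => g x - innerSL ℝ w₁ x) y := by
      refine Filter.Eventually.of_forall fun x => ?_
      have h1 : g y ≤ ⟪y, w₁⟫_ℝ := ciSup_le fun w => hmax w w.2
      have h2 : ⟪x, w₁⟫_ℝ ≤ g x := le_ciSup (hbdd x) ⟨w₁, hw₁⟩
      simp only [innerSL_apply_apply, real_inner_comm _ w₁]
      linarith
    have := hmin.hasFDerivAt_eq_zero (hy.hasFDerivAt.sub (innerSL ℝ w₁).hasFDerivAt)
    exact sub_eq_zero.1 this
  refine measure_mono_null ?_ (hlip.ae_differentiableAt (μ := volume))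
  rintro y ⟨w₁, h₁, w₂, h₂, hne, hm₁, hm₂⟩ hy
  have := (hderiv y hy w₁ h₁ hm₁).symm.trans (hderiv y hy w₂ h₂ hm₂)
  apply hne
  apply ext_inner_right ℝ
  intro v
  simpa using congrArg (fun f => f v) this

end RademacherNull

/-! ### Cone coordinates and cones with flat base. -/

section ConePoint

variable {V : Type*} [NormedAddCommGroup V] [InnerProductSpace ℝ V]

/-- The point with parameter `s` on the segment from `z` to `x`. -/
def conePoint (z : V) (p : V × ℝ) : V := (1 - p.2) • z + p.2 • p.1

theorem conePoint_sub (z : V) (p : V × ℝ) : conePoint z p - z = p.2 • (p.1 - z) := by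
  unfold conePoint; module

theorem conePoint_eq (z : V) (p : V × ℝ) : conePoint z p = z + p.2 • (p.1 - z) := by
  unfold conePoint; module

theorem conePoint_eq_homothety (z x : V) (s : ℝ) :
    conePoint z (x, s) = AffineMap.homothety z s x := by
  rw [conePoint_eq, AffineMap.homothety_apply]; simp [add_comm]

theorem continuous_conePoint (z : V) : Continuous (conePoint z) := by
  unfold conePoint; fun_prop

variable [FiniteDimensional ℝ V] [MeasurableSpace V] [BorelSpace V]

/-- Both `w₁` and `w₂` maximize `⟪x - z, ·⟫` over all `w` with `⟪k - z, w⟫ ≤ τ` on `K`. Since `y - z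
= s (x - z)` with `s ≥ 0`, they also maximize `⟪y - z, ·⟫`. That set of `w` may be unbounded, hence
the truncation to balls of integer radius. -/
theorem measure_conePoint_two_supports_eq_zero (K : Set V) (z : V) (τ : ℝ) :
    volume {y : V | ∃ x ∈ K, ∃ s : ℝ, 0 ≤ s ∧ y = conePoint z (x, s) ∧ ∃ w₁ w₂ : V, w₁ ≠ w₂ ∧
      (∀ k ∈ K, ⟪k - z, w₁⟫_ℝ ≤ τ) ∧ (∀ k ∈ K, ⟪k - z, w₂⟫_ℝ ≤ τ) ∧
      ⟪x - z, w₁⟫_ℝ = τ ∧ ⟪x - z, w₂⟫_ℝ = τ} = 0 := by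
  set L : ℕ → Set V := fun m => {w | ‖w‖ ≤ m ∧ ∀ k ∈ K, ⟪k - z, w⟫_ℝ ≤ τ}
  set N : ℕ → Set V := fun m => {y : V | ∃ w₁ ∈ L m, ∃ w₂ ∈ L m, w₁ ≠ w₂ ∧
    (∀ w ∈ L m, ⟪y, w⟫_ℝ ≤ ⟪y, w₁⟫_ℝ) ∧ ∀ w ∈ L m, ⟪y, w⟫_ℝ ≤ ⟪y, w₂⟫_ℝ}
  have hN : ∀ m, volume (N m) = 0 := fun m =>
    measure_setOf_two_maximizers_eq_zero (m := (m : ℝ≥0)) fun w hw => by simpa using hw.1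
  have hU : volume ((fun y => y - z) ⁻¹' (⋃ m, N m)) = 0 := by
    simp_rw [sub_eq_add_neg]
    rw [measure_preimage_add_right]
    exact measure_iUnion_null hN
  refine measure_mono_null ?_ hU
  rintro y ⟨x, hx, s, hs, rfl, w₁, w₂, hne, h₁, h₂, e₁, e₂⟩
  obtain ⟨m, hm⟩ := exists_nat_ge (max ‖w₁‖ ‖w₂‖)
  refine mem_iUnion.2 ⟨m, w₁, ⟨(le_max_left _ _).trans hm, h₁⟩, w₂,
    ⟨(le_max_right _ _).trans hm, h₂⟩, hne, ?_, ?_⟩ <;>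
  · intro w hw
    simp only [conePoint_sub, inner_smul_left, e₁, e₂]
    exact mul_le_mul_of_nonneg_left (hw.2 x hx) hs

end ConePoint

/-- The volume of a cone with apex `z` whose base lies in a hyperplane. -/
theorem volume_image_conePoint_flat {n : ℕ} {z u : EuclideanSpace ℝ (Fin n)} (hu : ‖u‖ = 1)
    {h₀ : ℝ} (h₀pos : 0 < h₀) {q : EuclideanSpace ℝ (Fin n) → EuclideanSpace ℝ (Fin n)}
    {W : Set (EuclideanSpace ℝ (Fin n) × ℝ)} (hW : ∀ p ∈ W, p.2 ∈ Ioo (0 : ℝ) 1)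
    (hq : ∀ p ∈ W, ⟪q p.1 - z, u⟫_ℝ = h₀)
    (hm : MeasurableSet ((fun p : EuclideanSpace ℝ (Fin n) × ℝ => conePoint z (q p.1, p.2)) '' W)) :
    volume ((fun p : EuclideanSpace ℝ (Fin n) × ℝ => conePoint z (q p.1, p.2)) '' W) =
      ∫⁻ s in Ioo (0 : ℝ) 1, ENNReal.ofReal (s ^ (n - 1)) *
        (ENNReal.ofReal h₀ * μHE[n - 1] (q '' {x | (x, s) ∈ W})) := by
  have hu0 : u ≠ 0 := by rintro rfl; simp at hu
  have huu : ⟪u, u⟫_ℝ = 1 := by rw [real_inner_self_eq_norm_sq, hu]; norm_num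
  -- Slicing along `h₀ • u` instead of `u` makes the slice parameter the cone parameter: the slice
  -- at `s` is the homothetic image of the base section with ratio `s`, which yields the factor
  -- `s^(n-1)`.
  set v := h₀ • u with hv
  have hv0 : v ≠ 0 := smul_ne_zero h₀pos.ne' hu0
  have key := EuclideanGeometry.euclideanHausdorffMeasure_eq_lintegral z hv0 hm
  rw [finrank_euclideanSpace_fin, EuclideanSpace.euclideanHausdorffMeasure_eq_volume] at key
  have hvn : ‖v‖ₑ = ENNReal.ofReal h₀ := by
    rw [hv, enorm_smul, Real.enorm_eq_ofReal h₀pos.le, ← ofReal_norm u, hu]; simp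
  rw [key, hvn, ← lintegral_const_mul' _ _ ENNReal.ofReal_ne_top,
    ← lintegral_indicator measurableSet_Ioo]
  congr 1 with s
  have hmem : ∀ y : EuclideanSpace ℝ (Fin n),
      y ∈ AffineSubspace.mk' (s • v +ᵥ z) (Submodule.span ℝ {v})ᗮ ↔ ⟪y - z, u⟫_ℝ = s * h₀ := by
    intro y
    rw [AffineSubspace.mem_mk', Submodule.mem_orthogonal_singleton_iff_inner_left]
    have : y -ᵥ (s • v +ᵥ z) = (y - z) - (s * h₀) • u := by
      simp [hv, smul_smul]; abel
    rw [this, hv, inner_smul_right, inner_sub_left, inner_smul_left, huu]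
    simp [h₀pos.ne', sub_eq_zero]
  have hval : ∀ p ∈ W, ⟪conePoint z (q p.1, p.2) - z, u⟫_ℝ = p.2 * h₀ := by
    intro p hp
    rw [conePoint_sub, inner_smul_left]
    simp [hq p hp]
  by_cases hs : s ∈ Ioo (0 : ℝ) 1
  · rw [indicator_of_mem hs]
    have hset : (fun p : EuclideanSpace ℝ (Fin n) × ℝ => conePoint z (q p.1, p.2)) '' W ∩
        AffineSubspace.mk' (s • v +ᵥ z) (Submodule.span ℝ {v})ᗮ =
        AffineMap.homothety z s '' (q '' {x | (x, s) ∈ W}) := by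
      ext y
      constructor
      · rintro ⟨⟨p, hp, rfl⟩, hy⟩
        have h1 := (hmem _).1 hy
        simp only [hval p hp] at h1
        have h2 : p.2 = s := mul_right_cancel₀ h₀pos.ne' h1
        subst h2
        exact ⟨q p.1, ⟨p.1, hp, rfl⟩, (conePoint_eq_homothety _ _ _).symm⟩
      · rintro ⟨_, ⟨x, hx, rfl⟩, rfl⟩
        refine ⟨⟨(x, s), hx, conePoint_eq_homothety _ _ _⟩, (hmem _).2 ?_⟩
        rw [← conePoint_eq_homothety]
        exact hval (x, s) hx
    rw [hset, euclideanHausdorffMeasure_homothety_image _ _ hs.1.ne']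
    rw [ENNReal.smul_def, smul_eq_mul, ENNReal.ofReal_pow hs.1.le,
      ← Real.enorm_eq_ofReal hs.1.le, ENNReal.coe_pow, enorm_eq_nnnorm]
    ring
  · rw [indicator_of_notMem hs]
    have hset : (fun p : EuclideanSpace ℝ (Fin n) × ℝ => conePoint z (q p.1, p.2)) '' W ∩
        AffineSubspace.mk' (s • v +ᵥ z) (Submodule.span ℝ {v})ᗮ = ∅ := by
      rw [eq_empty_iff_forall_notMem]
      rintro _ ⟨⟨p, hp, rfl⟩, hy⟩
      have h1 := (hmem _).1 hy
      simp only [hval p hp] at h1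
      exact hs (mul_right_cancel₀ h₀pos.ne' h1 ▸ hW p hp)
    rw [hset]; simp

/-- Projection along a compact factor is a closed map. This gives semicontinuity of normals and
stability of hulls. -/
theorem IsCompact.isClosed_setOf_exists_mem {X Y : Type*} [TopologicalSpace X] [TopologicalSpace Y]
    {C : Set Y} (hC : IsCompact C) {R : Set (X × Y)} (hR : IsClosed R) :
    IsClosed {x | ∃ y ∈ C, (x, y) ∈ R} := by
  have : CompactSpace C := isCompact_iff_compactSpace.1 hC
  have h : IsClosed ((fun p : X × C => (p.1, (p.2 : Y))) ⁻¹' R) :=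
    hR.preimage (by fun_prop)
  convert isClosedMap_fst_of_compactSpace _ h using 1
  ext x
  constructor
  · rintro ⟨y, hy, hxy⟩
    exact ⟨(x, ⟨y, hy⟩), hxy, rfl⟩
  · rintro ⟨⟨x', y⟩, hxy, rfl⟩
    exact ⟨y, y.2, hxy⟩

/-! ### Regularity of the normal and injectivity of cone coordinates. -/

section Normals

variable {n : ℕ} {K : Set (EuclideanSpace ℝ (Fin n))}

theorem outerNormal_spec {x : EuclideanSpace ℝ (Fin n)} (h : ∃! u, IsOuterUnitNormal K x u) :
    IsOuterUnitNormal K x (outerNormal K x) := by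
  unfold outerNormal
  rw [dif_pos h]
  exact h.choose_spec.1

theorem isClosed_setOf_isOuterUnitNormal :
    IsClosed {p : EuclideanSpace ℝ (Fin n) × EuclideanSpace ℝ (Fin n) |
      IsOuterUnitNormal K p.1 p.2} := by
  have : {p : EuclideanSpace ℝ (Fin n) × EuclideanSpace ℝ (Fin n) | IsOuterUnitNormal K p.1 p.2} =
      {p | ‖p.2‖ = 1} ∩ ⋂ y ∈ K, {p | ⟪y - p.1, p.2⟫_ℝ ≤ 0} := by
    ext p; simp [IsOuterUnitNormal]
  rw [this]
  refine (isClosed_eq (by fun_prop) (by fun_prop)).inter (isClosed_biInter fun y _ => ?_)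
  exact isClosed_le (by fun_prop) (by fun_prop)

/-- Outer unit normals depend upper semicontinuously on the point. -/
theorem eventually_norm_sub_outerNormal_lt {x₀ : EuclideanSpace ℝ (Fin n)}
    (h : ∃! u, IsOuterUnitNormal K x₀ u) {ε : ℝ} (hε : 0 < ε) :
    ∀ᶠ x in 𝓝 x₀, ∀ u, IsOuterUnitNormal K x u → ‖u - outerNormal K x₀‖ < ε := by
  have hcl := (isCompact_sphere (0 : EuclideanSpace ℝ (Fin n)) 1).isClosed_setOf_exists_mem
    (isClosed_setOf_isOuterUnitNormal (K := K) |>.inter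
      (isClosed_le (f := fun _ => ε) (g := fun p : EuclideanSpace ℝ (Fin n) ×
        EuclideanSpace ℝ (Fin n) => ‖p.2 - outerNormal K x₀‖) (by fun_prop) (by fun_prop)))
  have hx : x₀ ∉ {x | ∃ u ∈ Metric.sphere (0 : EuclideanSpace ℝ (Fin n)) 1, (x, u) ∈
      {p : EuclideanSpace ℝ (Fin n) × EuclideanSpace ℝ (Fin n) | IsOuterUnitNormal K p.1 p.2} ∩
      {p | ε ≤ ‖p.2 - outerNormal K x₀‖}} := by
    rintro ⟨u, -, hu, hu'⟩
    have hu'' : ε ≤ ‖u - outerNormal K x₀‖ := hu'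
    have hu₁ : u = outerNormal K x₀ := h.unique hu (outerNormal_spec h)
    rw [hu₁, sub_self, norm_zero] at hu''
    linarith
  filter_upwards [hcl.isOpen_compl.mem_nhds hx] with x hx u hu
  by_contra! hc
  exact hx ⟨u, by simpa using hu.1, hu, hc⟩

theorem continuousOn_outerNormal :
    ContinuousOn (outerNormal K) {x | ∃! u, IsOuterUnitNormal K x u} := by
  intro x₀ h₀
  rw [ContinuousWithinAt, Metric.tendsto_nhds]
  intro ε hε
  filter_upwards [nhdsWithin_le_nhds (eventually_norm_sub_outerNormal_lt h₀ hε),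
    self_mem_nhdsWithin] with x hx hx'
  rw [dist_eq_norm]
  exact hx _ (outerNormal_spec hx')

/-- Existence of a normal is a closed condition on `x`, and non-uniqueness is a countable union of
closed ones: two normals at distance at least `1 / (m + 1)`. -/
theorem measurableSet_existsUnique_isOuterUnitNormal :
    MeasurableSet {x | ∃! u, IsOuterUnitNormal K x u} := by
  have hS := isCompact_sphere (0 : EuclideanSpace ℝ (Fin n)) 1
  have h1 : IsClosed {x | ∃ u, IsOuterUnitNormal K x u} := by
    convert hS.isClosed_setOf_exists_mem (isClosed_setOf_isOuterUnitNormal (K := K)) using 1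
    ext x
    exact ⟨fun ⟨u, hu⟩ => ⟨u, by simpa using hu.1, hu⟩, fun ⟨u, _, hu⟩ => ⟨u, hu⟩⟩
  have h2 : ∀ m : ℕ, IsClosed {x | ∃ p ∈ Metric.sphere (0 : EuclideanSpace ℝ (Fin n)) 1 ×ˢ
      Metric.sphere (0 : EuclideanSpace ℝ (Fin n)) 1, (x, p) ∈
      {q : EuclideanSpace ℝ (Fin n) × (EuclideanSpace ℝ (Fin n) × EuclideanSpace ℝ (Fin n)) |
        IsOuterUnitNormal K q.1 q.2.1 ∧ IsOuterUnitNormal K q.1 q.2.2 ∧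
        1 / ((m : ℝ) + 1) ≤ ‖q.2.1 - q.2.2‖}} := by
    intro m
    refine (hS.prod hS).isClosed_setOf_exists_mem (IsClosed.inter ?_ (IsClosed.inter ?_ ?_))
    · exact (isClosed_setOf_isOuterUnitNormal (K := K)).preimage
        (f := fun q : EuclideanSpace ℝ (Fin n) × (EuclideanSpace ℝ (Fin n) ×
          EuclideanSpace ℝ (Fin n)) => (q.1, q.2.1)) (by fun_prop)
    · exact (isClosed_setOf_isOuterUnitNormal (K := K)).preimage
        (f := fun q : EuclideanSpace ℝ (Fin n) × (EuclideanSpace ℝ (Fin n) ×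
          EuclideanSpace ℝ (Fin n)) => (q.1, q.2.2)) (by fun_prop)
    · exact isClosed_le (f := fun _ => 1 / ((m : ℝ) + 1))
        (g := fun q : EuclideanSpace ℝ (Fin n) × (EuclideanSpace ℝ (Fin n) ×
          EuclideanSpace ℝ (Fin n)) => ‖q.2.1 - q.2.2‖) (by fun_prop) (by fun_prop)
  convert h1.measurableSet.diff (MeasurableSet.iUnion fun m => (h2 m).measurableSet) using 1
  ext x
  constructor
  · rintro hx
    refine ⟨hx.exists, fun hx' => ?_⟩
    obtain ⟨m, ⟨u, w⟩, -, hu, hw, hd⟩ := mem_iUnion.1 hx'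
    have hd' : 1 / ((m : ℝ) + 1) ≤ ‖u - w‖ := hd
    have huw : u = w := hx.unique hu hw
    rw [huw, sub_self, norm_zero] at hd'
    exact absurd hd' (not_le.2 (by positivity))
  · rintro ⟨⟨u, hu⟩, hx⟩
    refine ⟨u, hu, fun w hw => ?_⟩
    by_contra hne
    obtain ⟨m, hm⟩ := exists_nat_one_div_lt (norm_pos_iff.2 (sub_ne_zero.2 hne))
    exact hx (mem_iUnion.2 ⟨m, (w, u), ⟨by simpa using hw.1, by simpa using hu.1⟩, hw, hu, hm.le⟩)

/-- The smooth boundary points `x` of `K` for which `⟪x - z, n_K(x)⟫` has the sign `τ`. -/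
def coneBase (K : Set (EuclideanSpace ℝ (Fin n))) (z : EuclideanSpace ℝ (Fin n)) (τ : ℝ) :
    Set (EuclideanSpace ℝ (Fin n)) :=
  {x | x ∈ K ∧ x ∈ frontier K ∧ (∃! u, IsOuterUnitNormal K x u) ∧
    0 < τ * ⟪x - z, outerNormal K x⟫_ℝ}

variable {z : EuclideanSpace ℝ (Fin n)} {τ : ℝ}

theorem continuousOn_inner_outerNormal :
    ContinuousOn (fun x => ⟪x - z, outerNormal K x⟫_ℝ) {x | ∃! u, IsOuterUnitNormal K x u} :=
  (by fun_prop : ContinuousOn (fun x => x - z) _).inner continuousOn_outerNormal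

theorem measurableSet_coneBase (hK : IsClosed K) : MeasurableSet (coneBase K z τ) := by
  have hc : ContinuousOn (fun x => τ * ⟪x - z, outerNormal K x⟫_ℝ)
      {x | ∃! u, IsOuterUnitNormal K x u} :=
    continuousOn_const.mul continuousOn_inner_outerNormal
  obtain ⟨O, hO, hOe⟩ := continuousOn_iff'.1 hc _ (isOpen_Ioi (a := (0 : ℝ)))
  have : coneBase K z τ = K ∩ (frontier K ∩ (O ∩ {x | ∃! u, IsOuterUnitNormal K x u})) := by
    rw [← hOe]
    ext x
    simp only [coneBase, mem_inter_iff, mem_ofPred_eq, mem_preimage, mem_Ioi]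
    tauto
  rw [this]
  exact hK.measurableSet.inter (isClosed_frontier.measurableSet.inter
    (hO.measurableSet.inter measurableSet_existsUnique_isOuterUnitNormal))

/-- Two base points on one ray from `z` would contradict a supporting hyperplane: for `τ > 0` the
one at the nearer point excludes the farther point, for `τ < 0` the one at the farther point
excludes the nearer. -/
theorem injOn_conePoint_coneBase :
    InjOn (conePoint z) (coneBase K z τ ×ˢ Ioo (0 : ℝ) 1) := by
  have key : ∀ x ∈ coneBase K z τ, ∀ x' ∈ coneBase K z τ, ∀ s s' : ℝ, 0 < s → 0 < s' →
      conePoint z (x, s) = conePoint z (x', s') → ¬ (0 < τ ∧ s' < s) ∧ ¬ (τ < 0 ∧ s < s') := by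
    intro x hx x' hx' s s' hs hs' h
    have e : s * ⟪x - z, outerNormal K x⟫_ℝ = s' * ⟪x' - z, outerNormal K x⟫_ℝ := by
      have := congrArg (fun y => ⟪y - z, outerNormal K x⟫_ℝ) h
      simpa [conePoint_sub, inner_smul_left] using this
    have hle : ⟪x' - z, outerNormal K x⟫_ℝ ≤ ⟪x - z, outerNormal K x⟫_ℝ := by
      have := (outerNormal_spec hx.2.2.1).2 x' hx'.1
      rw [show x' - z = (x' - x) + (x - z) by abel, inner_add_left]
      linarith
    have hpos := hx.2.2.2
    constructor
    · rintro ⟨h1, h2⟩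
      have : 0 < ⟪x - z, outerNormal K x⟫_ℝ := (pos_iff_pos_of_mul_pos hpos).1 h1
      nlinarith
    · rintro ⟨h1, h2⟩
      have : ⟪x - z, outerNormal K x⟫_ℝ < 0 := (neg_iff_neg_of_mul_pos hpos).1 h1
      nlinarith
  rintro ⟨x, s⟩ ⟨hx, hs⟩ ⟨x', s'⟩ ⟨hx', hs'⟩ h
  have h1 := key x hx x' hx' s s' hs.1 hs'.1 h
  have h2 := key x' hx' x hx s' s hs'.1 hs.1 h.symm
  have hτ : τ ≠ 0 := by
    rintro rfl
    simpa using hx.2.2.2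
  have hss : s = s' := by
    rcases lt_trichotomy s s' with h3 | h3 | h3
    · rcases hτ.lt_or_gt with h4 | h4
      · exact absurd ⟨h4, h3⟩ h1.2
      · exact absurd ⟨h4, h3⟩ h2.1
    · exact h3
    · rcases hτ.lt_or_gt with h4 | h4
      · exact absurd ⟨h4, h3⟩ h2.2
      · exact absurd ⟨h4, h3⟩ h1.1
  subst hss
  have h3 : s • (x - z) = s • (x' - z) := by
    rw [← conePoint_sub z (x, s), h, conePoint_sub]
  have h4 := smul_right_injective _ hs.1.ne' h3
  rw [sub_left_inj.1 h4]

end Normals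

/-! ### Flattening the boundary onto a tangent hyperplane. -/

section LocalComparison

variable {n : ℕ} {K : Set (EuclideanSpace ℝ (Fin n))} {z : EuclideanSpace ℝ (Fin n)} {τ : ℝ}

/-- Near a smooth boundary point the boundary is almost contained in the tangent hyperplane. -/
theorem abs_inner_sub_outerNormal_le {x₀ x y : EuclideanSpace ℝ (Fin n)} {ε : ℝ}
    (hxK : x ∈ K) (hyK : y ∈ K) (hx : ∃! u, IsOuterUnitNormal K x u)
    (hy : ∃! u, IsOuterUnitNormal K y u) (hxε : ‖outerNormal K x - outerNormal K x₀‖ ≤ ε)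
    (hyε : ‖outerNormal K y - outerNormal K x₀‖ ≤ ε) :
    |⟪x - y, outerNormal K x₀⟫_ℝ| ≤ ε * ‖x - y‖ := by
  have h1 : ∀ a b : EuclideanSpace ℝ (Fin n), b ∈ K → (∃! u, IsOuterUnitNormal K a u) →
      ‖outerNormal K a - outerNormal K x₀‖ ≤ ε → ⟪b - a, outerNormal K x₀⟫_ℝ ≤ ε * ‖b - a‖ := by
    intro a b hb ha haε
    have h2 := (outerNormal_spec ha).2 b hb
    have h3 : ⟪b - a, outerNormal K x₀⟫_ℝ = ⟪b - a, outerNormal K a⟫_ℝ -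
        ⟪b - a, outerNormal K a - outerNormal K x₀⟫_ℝ := by
      rw [inner_sub_right]; ring
    have h4 := abs_real_inner_le_norm (b - a) (outerNormal K a - outerNormal K x₀)
    have h5 : ‖b - a‖ * ‖outerNormal K a - outerNormal K x₀‖ ≤ ‖b - a‖ * ε := by gcongr
    have h6 := neg_abs_le ⟪b - a, outerNormal K a - outerNormal K x₀⟫_ℝ
    rw [h3]; linarith
  rw [abs_le]
  constructor
  · have := h1 x y hyK hx hxε
    rw [← neg_sub x y, inner_neg_left, norm_neg] at this
    linarith
  · exact h1 y x hxK hy hyε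

/-- Projection onto the hyperplane through `x₀` orthogonal to the unit vector `u`. -/
noncomputable def flatten (x₀ u x : EuclideanSpace ℝ (Fin n)) : EuclideanSpace ℝ (Fin n) :=
  x - ⟪x - x₀, u⟫_ℝ • u

section Flatten

variable {x₀ u x x' : EuclideanSpace ℝ (Fin n)}

theorem continuous_flatten : Continuous (flatten x₀ u) := by
  unfold flatten; fun_prop

theorem inner_flatten_sub (hu : ‖u‖ = 1) :
    ⟪flatten x₀ u x - z, u⟫_ℝ = ⟪x₀ - z, u⟫_ℝ := by
  have huu : ⟪u, u⟫_ℝ = 1 := by rw [real_inner_self_eq_norm_sq, hu]; norm_num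
  simp only [flatten, inner_sub_left, inner_smul_left, huu]
  simp

theorem flatten_sub_flatten :
    flatten x₀ u x - flatten x₀ u x' = (x - x') - ⟪x - x', u⟫_ℝ • u := by
  have : ⟪x - x', u⟫_ℝ = ⟪x - x₀, u⟫_ℝ - ⟪x' - x₀, u⟫_ℝ := by
    rw [← inner_sub_left]; simp
  rw [this, flatten, flatten]; module

theorem norm_flatten_sub_flatten_le (hu : ‖u‖ = 1) :
    ‖flatten x₀ u x - flatten x₀ u x'‖ ≤ ‖x - x'‖ := by
  have huu : ⟪u, u⟫_ℝ = 1 := by rw [real_inner_self_eq_norm_sq, hu]; norm_num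
  rw [flatten_sub_flatten]
  refine le_of_sq_le_sq ?_ (norm_nonneg _)
  rw [norm_sub_sq_real, inner_smul_right, norm_smul, hu, mul_one, Real.norm_eq_abs, sq_abs]
  nlinarith [sq_nonneg ⟪x - x', u⟫_ℝ]

theorem norm_sub_le_flatten (hu : ‖u‖ = 1) {ε : ℝ} (h : |⟪x - x', u⟫_ℝ| ≤ ε * ‖x - x'‖) :
    (1 - ε) * ‖x - x'‖ ≤ ‖flatten x₀ u x - flatten x₀ u x'‖ := by
  rw [flatten_sub_flatten]
  have := norm_sub_norm_le (x - x') (⟪x - x', u⟫_ℝ • u)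
  rw [norm_smul, hu, mul_one, Real.norm_eq_abs] at this
  linarith

theorem conePoint_sub_flatten (s s' : ℝ) :
    (conePoint z (x, s) - conePoint z (x', s')) -
      (conePoint z (flatten x₀ u x, s) - conePoint z (flatten x₀ u x', s')) =
      (s * ⟪x - x₀, u⟫_ℝ - s' * ⟪x' - x₀, u⟫_ℝ) • u := by
  simp only [conePoint, flatten]
  module

/-- Flattening the base of a cone is almost an isometry of the cone. -/
theorem norm_conePoint_sub_flatten_le (hu : ‖u‖ = 1) {h₀ R ε s s' : ℝ}
    (hh₀ : 0 < h₀) (hh : ⟪x₀ - z, u⟫_ℝ = h₀) (hs' : 0 < s')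
    (hR : ‖flatten x₀ u x - z‖ ≤ R) (hε : 0 < ε) (hε2 : ε ≤ 1 / 2)
    (hx₀ : |⟪x - x₀, u⟫_ℝ| ≤ ε) (hxx' : |⟪x - x', u⟫_ℝ| ≤ ε * ‖x - x'‖) :
    s' * ‖x - x'‖ ≤ 2 * (R / h₀ + 1) *
        ‖conePoint z (flatten x₀ u x, s) - conePoint z (flatten x₀ u x', s')‖ ∧
    |s - s'| * h₀ ≤ ‖conePoint z (flatten x₀ u x, s) - conePoint z (flatten x₀ u x', s')‖ ∧
    ‖(conePoint z (x, s) - conePoint z (x', s')) -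
      (conePoint z (flatten x₀ u x, s) - conePoint z (flatten x₀ u x', s'))‖ ≤
      ε * (2 * (R / h₀ + 1) + 1 / h₀) *
        ‖conePoint z (flatten x₀ u x, s) - conePoint z (flatten x₀ u x', s')‖ := by
  set D := conePoint z (flatten x₀ u x, s) - conePoint z (flatten x₀ u x', s') with hD
  have hDz : D = s • (flatten x₀ u x - z) - s' • (flatten x₀ u x' - z) := by
    rw [hD, conePoint_eq, conePoint_eq]; simp
  -- The flattened base lies at height `h₀`, so the component of `D` along `u` is `(s - s') h₀`.
  -- Thus `D` controls the change of parameter and, once this is subtracted, also the displacement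
  -- within the base.
  have h1 : |s - s'| * h₀ ≤ ‖D‖ := by
    have : ⟪D, u⟫_ℝ = (s - s') * h₀ := by
      rw [hDz, inner_sub_left, inner_smul_left, inner_smul_left, inner_flatten_sub hu,
        inner_flatten_sub hu, hh]
      simp; ring
    have h2 := abs_real_inner_le_norm D u
    rwa [this, hu, mul_one, abs_mul, abs_of_pos hh₀] at h2
  have h1' : |s - s'| ≤ ‖D‖ / h₀ := (le_div_iff₀ hh₀).2 h1
  have hR0 : 0 ≤ R := (norm_nonneg _).trans hR
  have h2 : s' * ‖flatten x₀ u x - flatten x₀ u x'‖ ≤ (R / h₀ + 1) * ‖D‖ := by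
    have e : s' • (flatten x₀ u x - flatten x₀ u x') = D - (s - s') • (flatten x₀ u x - z) := by
      rw [hDz]; module
    have := norm_sub_le D ((s - s') • (flatten x₀ u x - z))
    rw [← e, norm_smul, norm_smul, Real.norm_eq_abs, Real.norm_eq_abs, abs_of_pos hs'] at this
    have h3 : |s - s'| * ‖flatten x₀ u x - z‖ ≤ ‖D‖ / h₀ * R := by gcongr
    calc _ ≤ _ := this
      _ ≤ ‖D‖ + ‖D‖ / h₀ * R := by linarith
      _ = _ := by ring
  have h3 : s' * ‖x - x'‖ ≤ 2 * (R / h₀ + 1) * ‖D‖ := by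
    have := norm_sub_le_flatten (x₀ := x₀) hu hxx'
    have h4 : (1 / 2) * ‖x - x'‖ ≤ ‖flatten x₀ u x - flatten x₀ u x'‖ := by
      refine le_trans ?_ this
      gcongr; linarith
    have h5 : s' * ((1 / 2) * ‖x - x'‖) ≤ s' * ‖flatten x₀ u x - flatten x₀ u x'‖ := by gcongr
    linarith
  refine ⟨h3, h1, ?_⟩
  rw [conePoint_sub_flatten, norm_smul, hu, mul_one, Real.norm_eq_abs]
  have e : s * ⟪x - x₀, u⟫_ℝ - s' * ⟪x' - x₀, u⟫_ℝ =
      (s - s') * ⟪x - x₀, u⟫_ℝ + s' * ⟪x - x', u⟫_ℝ := by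
    have : ⟪x - x', u⟫_ℝ = ⟪x - x₀, u⟫_ℝ - ⟪x' - x₀, u⟫_ℝ := by
      rw [← inner_sub_left]; simp
    rw [this]; ring
  rw [e]
  refine (abs_add_le _ _).trans ?_
  rw [abs_mul, abs_mul, abs_of_pos hs']
  have h6 : |s - s'| * |⟪x - x₀, u⟫_ℝ| ≤ ‖D‖ / h₀ * ε := by gcongr
  have h7 : s' * |⟪x - x', u⟫_ℝ| ≤ ε * (2 * (R / h₀ + 1) * ‖D‖) := by
    calc _ ≤ s' * (ε * ‖x - x'‖) := by gcongr
      _ = ε * (s' * ‖x - x'‖) := by ring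
      _ ≤ _ := by gcongr
  calc _ ≤ _ := add_le_add h6 h7
    _ = _ := by ring

end Flatten

end LocalComparison

/-! ### Local volume comparison for cones. -/

section ConeMeasure

variable {n : ℕ} {K : Set (EuclideanSpace ℝ (Fin n))} {z : EuclideanSpace ℝ (Fin n)} {τ : ℝ}

theorem abs_inner_outerNormal_of_mem_coneBase (hτ : |τ| = 1) {x : EuclideanSpace ℝ (Fin n)}
    (hx : x ∈ coneBase K z τ) :
    |⟪z - x, outerNormal K x⟫_ℝ| = τ * ⟪x - z, outerNormal K x⟫_ℝ := by
  rw [← neg_sub x z, inner_neg_left, abs_neg, ← abs_of_pos hx.2.2.2, abs_mul, hτ, one_mul]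

/-- Near `x₀` all normals are close to the one at `x₀`, so the boundary has small slope over the
tangent hyperplane. The sign `τ` in `u = τ n_K(x₀)` makes the height of that hyperplane over `z`
positive. -/
theorem exists_flatten_comparison (hτ : |τ| = 1) {x₀ : EuclideanSpace ℝ (Fin n)}
    (hx₀ : x₀ ∈ coneBase K z τ) {a : ℝ≥0} (ha : 1 < a) :
    ∃ O ∈ 𝓝 x₀, ∃ u : EuclideanSpace ℝ (Fin n), ‖u‖ = 1 ∧ 0 < ⟪x₀ - z, u⟫_ℝ ∧
      ∀ x ∈ coneBase K z τ ∩ O,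
        |⟪z - x, outerNormal K x⟫_ℝ| ≤ a * ⟪x₀ - z, u⟫_ℝ ∧
        ⟪x₀ - z, u⟫_ℝ ≤ a * |⟪z - x, outerNormal K x⟫_ℝ| ∧
        ∀ x' ∈ coneBase K z τ ∩ O,
          dist x x' ≤ a * dist (flatten x₀ u x) (flatten x₀ u x') ∧
          ∀ s ∈ Ioo (0 : ℝ) 1, ∀ s' ∈ Ioo (0 : ℝ) 1,
            dist (conePoint z (x, s)) (conePoint z (x', s')) ≤
              a * dist (conePoint z (flatten x₀ u x, s)) (conePoint z (flatten x₀ u x', s')) ∧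
            dist (conePoint z (flatten x₀ u x, s)) (conePoint z (flatten x₀ u x', s')) ≤
              a * dist (conePoint z (x, s)) (conePoint z (x', s')) := by
  have ha1 : (1 : ℝ) < a := by exact_mod_cast ha
  have ha0 : (0 : ℝ) < a := by linarith
  set u := τ • outerNormal K x₀ with hu_def
  have hspec := outerNormal_spec hx₀.2.2.1
  have hu : ‖u‖ = 1 := by rw [hu_def, norm_smul, hspec.1, mul_one, Real.norm_eq_abs, hτ]
  set h₀ := ⟪x₀ - z, u⟫_ℝ with hh₀
  have hpos : 0 < h₀ := by rw [hh₀, hu_def, inner_smul_right]; exact hx₀.2.2.2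
  set R : ℝ := 1 + ‖x₀ - z‖ with hRdef
  set B : ℝ := 2 * (R / h₀ + 1) + 1 / h₀ with hB
  have hB0 : 0 < B := by positivity
  -- This `η` gives both `1 + η ≤ a` and `a (1 - η) = 1`, so a relative error `η` costs at most a
  -- factor `a` in either direction.
  set η : ℝ := 1 - 1 / a with hη
  have hη0 : 0 < η := by
    rw [hη, sub_pos, div_lt_one ha0]; exact ha1
  have hηa : 1 + η ≤ a := by
    have : 0 ≤ ((a : ℝ) - 1) ^ 2 / a := by positivity
    have e : ((a : ℝ) - 1) ^ 2 / a = a - (1 + η) := by rw [hη]; field_simp; ring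
    linarith
  have hηa' : a * (1 - η) = 1 := by rw [hη]; field_simp; ring
  -- The bound `η` serves distances in the base, `η / B` distances in the cone, and `1 / 2` is
  -- required by `norm_conePoint_sub_flatten_le`.
  set ε : ℝ := min (min (1 / 2) η) (η / B) with hε
  have hε0 : 0 < ε := by positivity
  have hε2 : ε ≤ 1 / 2 := (min_le_left _ _).trans (min_le_left _ _)
  have hεη : ε ≤ η := (min_le_left _ _).trans (min_le_right _ _)
  have hεB : ε * B ≤ η := (le_div_iff₀ hB0).1 (min_le_right _ _)
  have hcont : ∀ᶠ x in 𝓝[{x | ∃! u, IsOuterUnitNormal K x u}] x₀,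
      |⟪x - z, outerNormal K x⟫_ℝ - ⟪x₀ - z, outerNormal K x₀⟫_ℝ| < η * h₀ := by
    have := (continuousOn_inner_outerNormal (z := z)) x₀ hx₀.2.2.1
    simpa [Real.dist_eq] using (Metric.tendsto_nhds.1 this) (η * h₀) (by positivity)
  obtain ⟨O₁, hO₁, hO₁'⟩ := mem_nhdsWithin_iff_exists_mem_nhds_inter.1 hcont
  refine ⟨O₁ ∩ ({x | ∀ w, IsOuterUnitNormal K x w → ‖w - outerNormal K x₀‖ < ε} ∩
    Metric.ball x₀ 1), inter_mem hO₁ (inter_mem (eventually_norm_sub_outerNormal_lt hx₀.2.2.1 hε0)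
    (Metric.ball_mem_nhds _ one_pos)), u, hu, hpos, ?_⟩
  rintro x ⟨hx, hxO₁, hxN, hxB⟩
  have hxabs := abs_inner_outerNormal_of_mem_coneBase hτ hx
  have hclose : |(|⟪z - x, outerNormal K x⟫_ℝ|) - h₀| ≤ η * h₀ := by
    have h1 : |⟪x - z, outerNormal K x⟫_ℝ - ⟪x₀ - z, outerNormal K x₀⟫_ℝ| < η * h₀ :=
      hO₁' ⟨hxO₁, hx.2.2.1⟩
    rw [hxabs, hh₀, hu_def, inner_smul_right, ← mul_sub, abs_mul, hτ, one_mul,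
      ← inner_smul_right, ← hu_def]
    exact h1.le
  obtain ⟨hc1, hc2⟩ := abs_le.1 hclose
  refine ⟨?_, ?_, ?_⟩
  · nlinarith
  · have : (1 - η) * h₀ ≤ |⟪z - x, outerNormal K x⟫_ℝ| := by linarith
    calc h₀ = a * ((1 - η) * h₀) := by rw [← mul_assoc, hηa', one_mul]
      _ ≤ _ := by gcongr
  have hflat : ∀ {y y'}, y ∈ coneBase K z τ → y' ∈ coneBase K z τ →
      (∀ w, IsOuterUnitNormal K y w → ‖w - outerNormal K x₀‖ < ε) →
      (∀ w, IsOuterUnitNormal K y' w → ‖w - outerNormal K x₀‖ < ε) →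
      |⟪y - y', u⟫_ℝ| ≤ ε * ‖y - y'‖ := by
    intro y y' hy hy' hyN hy'N
    rw [hu_def, inner_smul_right, abs_mul, hτ, one_mul]
    exact abs_inner_sub_outerNormal_le hy.1 hy'.1 hy.2.2.1 hy'.2.2.1
      (hyN _ (outerNormal_spec hy.2.2.1)).le (hy'N _ (outerNormal_spec hy'.2.2.1)).le
  have hx₀N : ∀ w, IsOuterUnitNormal K x₀ w → ‖w - outerNormal K x₀‖ < ε := by
    intro w hw
    rw [hx₀.2.2.1.unique hw hspec]; simpa using hε0
  rintro x' ⟨hx', -, hx'N, -⟩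
  have hxx' := hflat hx hx' hxN hx'N
  have hxB' : ‖x - x₀‖ < 1 := by rwa [mem_ball_iff_norm] at hxB
  constructor
  · have h1 := norm_sub_le_flatten (x₀ := x₀) hu hxx'
    rw [dist_eq_norm, dist_eq_norm]
    have h2 : (1 - η) * ‖x - x'‖ ≤ ‖flatten x₀ u x - flatten x₀ u x'‖ :=
      le_trans (by gcongr) h1
    calc ‖x - x'‖ = a * ((1 - η) * ‖x - x'‖) := by rw [← mul_assoc, hηa', one_mul]
      _ ≤ _ := by gcongr
  intro s hs s' hs'
  have hR : ‖flatten x₀ u x - z‖ ≤ R := by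
    have h1 : flatten x₀ u x₀ = x₀ := by simp [flatten]
    have h2 := norm_flatten_sub_flatten_le (x₀ := x₀) (x := x) (x' := x₀) hu
    rw [h1] at h2
    calc ‖flatten x₀ u x - z‖ = ‖(flatten x₀ u x - x₀) + (x₀ - z)‖ := by congr 1; abel
      _ ≤ _ := norm_add_le _ _
      _ ≤ R := by rw [hRdef]; linarith
  have hx₀ε : |⟪x - x₀, u⟫_ℝ| ≤ ε := by
    refine (hflat hx hx₀ hxN hx₀N).trans ?_
    nlinarith
  have h3 := (norm_conePoint_sub_flatten_le (s := s) hu hpos hh₀.symm hs'.1 hR hε0 hε2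
    hx₀ε hxx').2.2
  rw [dist_eq_norm, dist_eq_norm]
  set D := conePoint z (flatten x₀ u x, s) - conePoint z (flatten x₀ u x', s')
  set D' := conePoint z (x, s) - conePoint z (x', s')
  have h4 : ‖D' - D‖ ≤ η * ‖D‖ := h3.trans (by gcongr)
  constructor
  · have := norm_le_norm_add_norm_sub' D' D
    calc ‖D'‖ ≤ ‖D‖ + ‖D' - D‖ := this
      _ ≤ (1 + η) * ‖D‖ := by linarith
      _ ≤ _ := by gcongr
  · have := norm_le_norm_add_norm_sub' D D'
    rw [norm_sub_rev D D'] at this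
    have h5 : (1 - η) * ‖D‖ ≤ ‖D'‖ := by linarith
    calc ‖D‖ = a * ((1 - η) * ‖D‖) := by rw [← mul_assoc, hηa', one_mul]
      _ ≤ _ := by gcongr

theorem measurableSet_image_conePoint {W : Set (EuclideanSpace ℝ (Fin n) × ℝ)}
    (hWm : MeasurableSet W) (hW : W ⊆ coneBase K z τ ×ˢ Ioo (0 : ℝ) 1) :
    MeasurableSet (conePoint z '' W) :=
  hWm.image_of_continuousOn_injOn (continuous_conePoint z).continuousOn
    (injOn_conePoint_coneBase.mono hW)

/-- Local comparison of the volume of a cone with the integral over its base. -/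
theorem exists_nhds_volume_image_conePoint_comparison (hτ : |τ| = 1)
    {x₀ : EuclideanSpace ℝ (Fin n)} (hx₀ : x₀ ∈ coneBase K z τ) {a : ℝ≥0} (ha : 1 < a) :
    ∃ O ∈ 𝓝 x₀, ∀ W : Set (EuclideanSpace ℝ (Fin n) × ℝ), MeasurableSet W →
      W ⊆ (coneBase K z τ ∩ O) ×ˢ Ioo (0 : ℝ) 1 →
      volume (conePoint z '' W) ≤ (a : ℝ≥0∞) ^ n * a *
        ∫⁻ s in Ioo (0 : ℝ) 1, ENNReal.ofReal (s ^ (n - 1)) *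
          ∫⁻ x in {x | (x, s) ∈ W}, ENNReal.ofReal |⟪z - x, outerNormal K x⟫_ℝ| ∂μHE[n - 1] ∧
      ∫⁻ s in Ioo (0 : ℝ) 1, ENNReal.ofReal (s ^ (n - 1)) *
          ∫⁻ x in {x | (x, s) ∈ W}, ENNReal.ofReal |⟪z - x, outerNormal K x⟫_ℝ| ∂μHE[n - 1] ≤
        (a : ℝ≥0∞) * a ^ (n - 1) * a ^ n * volume (conePoint z '' W) := by
  obtain ⟨O, hO, u, hu, hpos, hcomp⟩ := exists_flatten_comparison hτ hx₀ ha
  refine ⟨O, hO, fun W hWm hW => ?_⟩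
  set h₀ := ⟪x₀ - z, u⟫_ℝ with hh₀
  set q := flatten x₀ u with hq
  have hmem : ∀ p ∈ W, p.1 ∈ coneBase K z τ ∩ O ∧ p.2 ∈ Ioo (0 : ℝ) 1 := fun p hp => hW hp
  have hle1 : ∀ p ∈ W, ∀ p' ∈ W, dist (conePoint z p) (conePoint z p') ≤
      a * dist (conePoint z (q p.1, p.2)) (conePoint z (q p'.1, p'.2)) := fun p hp p' hp' =>
    (((hcomp p.1 (hmem p hp).1).2.2 p'.1 (hmem p' hp').1).2 p.2 (hmem p hp).2 p'.2
      (hmem p' hp').2).1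
  have hle2 : ∀ p ∈ W, ∀ p' ∈ W, dist (conePoint z (q p.1, p.2)) (conePoint z (q p'.1, p'.2)) ≤
      a * dist (conePoint z p) (conePoint z p') := fun p hp p' hp' =>
    (((hcomp p.1 (hmem p hp).1).2.2 p'.1 (hmem p' hp').1).2 p.2 (hmem p hp).2 p'.2
      (hmem p' hp').2).2
  have hinjG : InjOn (conePoint z) W :=
    injOn_conePoint_coneBase.mono (hW.trans (prod_mono inter_subset_left subset_rfl))
  have hinj : InjOn (fun p : EuclideanSpace ℝ (Fin n) × ℝ => conePoint z (q p.1, p.2)) W := by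
    intro p hp p' hp' h
    have := hle1 p hp p' hp'
    rw [show conePoint z (q p.1, p.2) = conePoint z (q p'.1, p'.2) from h, dist_self,
      mul_zero] at this
    exact hinjG hp hp' (dist_le_zero.1 this)
  have hqc : Continuous q := continuous_flatten
  have hcont : Continuous fun p : EuclideanSpace ℝ (Fin n) × ℝ => conePoint z (q p.1, p.2) :=
    (continuous_conePoint z).comp (by fun_prop)
  have hm := hWm.image_of_continuousOn_injOn hcont.continuousOn hinj
  have hflatvol := volume_image_conePoint_flat hu hpos (q := q) (W := W)
    (fun p hp => (hmem p hp).2) (fun p _ => inner_flatten_sub hu) hm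
  have hv1 := euclideanHausdorffMeasure_image_le_of_dist_le n hle1
  have hv2 := euclideanHausdorffMeasure_image_le_of_dist_le n hle2
  rw [EuclideanSpace.euclideanHausdorffMeasure_eq_volume] at hv1 hv2
  have hsec : ∀ s : ℝ, MeasurableSet {x | (x, s) ∈ W} := fun s =>
    hWm.preimage (by fun_prop : Measurable fun x : EuclideanSpace ℝ (Fin n) => (x, s))
  -- Flattening is an orthogonal projection, hence 1-Lipschitz, so this direction costs no power of
  -- `a`; the converse costs `a^(n-1)`. The remaining factors are `a^n` for the volume and `a` for
  -- the density.
  have hq1 : ∀ s : ℝ, μHE[n - 1] (q '' {x | (x, s) ∈ W}) ≤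
      (μHE[n - 1] : Measure (EuclideanSpace ℝ (Fin n))) {x | (x, s) ∈ W} := by
    intro s
    have := euclideanHausdorffMeasure_image_le_of_dist_le (n - 1) (a := q) (b := id) (c := 1)
      (W := {x | (x, s) ∈ W}) (fun x _ x' _ => by
        rw [NNReal.coe_one, one_mul, dist_eq_norm, dist_eq_norm]
        exact norm_flatten_sub_flatten_le hu)
    simpa using this
  have hq2 : ∀ s : ℝ, (μHE[n - 1] : Measure (EuclideanSpace ℝ (Fin n))) {x | (x, s) ∈ W} ≤
      (a : ℝ≥0∞) ^ (n - 1) * μHE[n - 1] (q '' {x | (x, s) ∈ W}) := by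
    intro s
    have := euclideanHausdorffMeasure_image_le_of_dist_le (n - 1) (a := id) (b := q) (c := a)
      (W := {x | (x, s) ∈ W}) (fun x hx x' hx' =>
        ((hcomp x (hmem _ hx).1).2.2 x' (hmem _ hx').1).1)
    simpa using this
  have hofa : ∀ t : ℝ, ENNReal.ofReal (a * t) = a * ENNReal.ofReal t := fun t => by
    rw [ENNReal.ofReal_mul a.coe_nonneg, ENNReal.ofReal_coe_nnreal]
  constructor
  · refine hv1.trans ?_
    rw [hflatvol, mul_assoc]
    gcongr
    rw [← lintegral_const_mul' _ _ ENNReal.coe_ne_top]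
    refine lintegral_mono fun s => ?_
    rw [mul_left_comm (a : ℝ≥0∞)]
    refine mul_le_mul' le_rfl ?_
    calc ENNReal.ofReal h₀ * μHE[n - 1] (q '' {x | (x, s) ∈ W})
        ≤ ENNReal.ofReal h₀ * μHE[n - 1] {x | (x, s) ∈ W} := mul_le_mul' le_rfl (hq1 s)
      _ = ∫⁻ x in {x | (x, s) ∈ W}, ENNReal.ofReal h₀ ∂μHE[n - 1] := by
        rw [setLIntegral_const]
      _ ≤ ∫⁻ x in {x | (x, s) ∈ W}, a * ENNReal.ofReal |⟪z - x, outerNormal K x⟫_ℝ| ∂μHE[n - 1] := by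
        refine setLIntegral_mono' (hsec s) fun x hx => ?_
        rw [← hofa]
        exact ENNReal.ofReal_le_ofReal (hcomp x (hmem _ hx).1).2.1
      _ = _ := lintegral_const_mul' _ _ ENNReal.coe_ne_top
  · calc _ ≤ ∫⁻ s in Ioo (0 : ℝ) 1, (a * a ^ (n - 1)) * (ENNReal.ofReal (s ^ (n - 1)) *
          (ENNReal.ofReal h₀ * μHE[n - 1] (q '' {x | (x, s) ∈ W}))) := by
          refine lintegral_mono fun s => ?_
          rw [mul_left_comm]
          gcongr
          calc _ ≤ ∫⁻ x in {x | (x, s) ∈ W}, a * ENNReal.ofReal h₀ ∂μHE[n - 1] := by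
                refine setLIntegral_mono' (hsec s) fun x hx => ?_
                rw [← hofa]
                exact ENNReal.ofReal_le_ofReal (hcomp x (hmem _ hx).1).1
            _ = a * ENNReal.ofReal h₀ * μHE[n - 1] {x | (x, s) ∈ W} := by rw [setLIntegral_const]
            _ ≤ a * ENNReal.ofReal h₀ * (a ^ (n - 1) * μHE[n - 1] (q '' {x | (x, s) ∈ W})) :=
                mul_le_mul' le_rfl (hq2 s)
            _ = _ := by ring
      _ = (a * a ^ (n - 1)) * volume
          ((fun p : EuclideanSpace ℝ (Fin n) × ℝ => conePoint z (q p.1, p.2)) '' W) := by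
          rw [hflatvol, lintegral_const_mul']
          finiteness
      _ ≤ _ := by
          rw [mul_assoc _ ((a : ℝ≥0∞) ^ n)]
          gcongr

end ConeMeasure

theorem ENNReal.le_of_forall_one_lt_le_pow_mul {x y : ℝ≥0∞} (N : ℕ)
    (h : ∀ a : ℝ≥0, 1 < a → x ≤ (a : ℝ≥0∞) ^ N * y) : x ≤ y := by
  have h1 : Tendsto (fun a : ℝ≥0 => (a : ℝ≥0∞) ^ N) (𝓝[>] 1) (𝓝 1) := by
    have : Continuous fun a : ℝ≥0 => (a : ℝ≥0∞) ^ N := by fun_prop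
    have := (this.tendsto 1).mono_left (nhdsWithin_le_nhds (s := Ioi 1))
    simpa using this
  have h2 := ENNReal.Tendsto.mul_const (b := y) h1 (Or.inl one_ne_zero)
  rw [one_mul] at h2
  exact ge_of_tendsto h2 (eventually_nhdsWithin_of_forall h)

/-- Countable cover of `s` by pairwise disjoint measurable sets, each contained in one of the
given neighbourhoods. -/
theorem exists_disjoint_measurable_cover {X : Type*} [TopologicalSpace X]
    [SecondCountableTopology X] [MeasurableSpace X] [OpensMeasurableSpace X] {s : Set X}
    (f : X → Set X) (hf : ∀ x ∈ s, f x ∈ 𝓝 x) :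
    ∃ A : ℕ → Set X, (∀ i, MeasurableSet (A i)) ∧ Pairwise (Function.onFun Disjoint A) ∧
      (∀ i, A i = ∅ ∨ ∃ x ∈ s, A i ⊆ f x) ∧ s ⊆ ⋃ i, A i := by
  rcases s.eq_empty_or_nonempty with rfl | hne
  · exact ⟨fun _ => ∅, fun _ => MeasurableSet.empty, fun _ _ _ => by simp [Function.onFun],
      fun _ => Or.inl rfl, empty_subset _⟩
  obtain ⟨t, hts, htc, hcov⟩ := TopologicalSpace.countable_cover_nhdsWithin (s := s)
    (f := fun x => interior (f x))
    fun x hx => mem_nhdsWithin_of_mem_nhds (interior_mem_nhds.2 (hf x hx))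
  have htne : t.Nonempty := by
    by_contra h
    rw [not_nonempty_iff_eq_empty] at h
    subst h
    obtain ⟨x, hx⟩ := hne
    simpa using hcov hx
  obtain ⟨e, rfl⟩ := htc.exists_eq_range htne
  refine ⟨disjointed fun i => interior (f (e i)),
    fun i => MeasurableSet.disjointed (fun i => isOpen_interior.measurableSet) i,
    disjoint_disjointed _, fun i => Or.inr ⟨e i, hts (mem_range_self i),
      (disjointed_subset _ i).trans interior_subset⟩, ?_⟩
  rw [iUnion_disjointed]
  simpa using hcov

/-! ### The exact cone formula and polar coordinates. -/

section ConeMeasure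

variable {n : ℕ} {K : Set (EuclideanSpace ℝ (Fin n))} {z : EuclideanSpace ℝ (Fin n)} {τ : ℝ}

/-- The surface measure of `K` on `coneBase K z τ`, weighted by `|⟪z - x, n_K(x)⟫|`. -/
noncomputable def coneBaseMeasure (K : Set (EuclideanSpace ℝ (Fin n)))
    (z : EuclideanSpace ℝ (Fin n)) (τ : ℝ) : Measure (EuclideanSpace ℝ (Fin n)) :=
  (μHE[n - 1].restrict (coneBase K z τ)).withDensity
    fun x => ENNReal.ofReal |⟪z - x, outerNormal K x⟫_ℝ|

/-- The measure `s^m ds` on the unit interval. -/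
noncomputable def radialMeasure (m : ℕ) : Measure ℝ :=
  (volume.restrict (Ioo (0 : ℝ) 1)).withDensity fun s => ENNReal.ofReal (s ^ m)

instance (m : ℕ) : SFinite (radialMeasure m) := by
  unfold radialMeasure; infer_instance

theorem coneBaseMeasure_apply {S : Set (EuclideanSpace ℝ (Fin n))} (hS : MeasurableSet S)
    (h : S ⊆ coneBase K z τ) : coneBaseMeasure K z τ S =
      ∫⁻ x in S, ENNReal.ofReal |⟪z - x, outerNormal K x⟫_ℝ| ∂μHE[n - 1] := by
  rw [coneBaseMeasure, withDensity_apply _ hS, Measure.restrict_restrict hS,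
    inter_eq_self_of_subset_left h]

theorem lintegral_radialMeasure (m : ℕ) {f : ℝ → ℝ≥0∞} (hf : Measurable f) :
    ∫⁻ s, f s ∂radialMeasure m = ∫⁻ s in Ioo (0 : ℝ) 1, ENNReal.ofReal (s ^ m) * f s := by
  rw [radialMeasure, lintegral_withDensity_eq_lintegral_mul _ (by fun_prop) hf]
  rfl

theorem radialMeasure_ne_zero (m : ℕ) : radialMeasure m univ ≠ 0 := by
  rw [radialMeasure, withDensity_apply _ MeasurableSet.univ, Measure.restrict_univ]
  refine (setLIntegral_pos_iff (by fun_prop)).2 ?_ |>.ne'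
  refine lt_of_lt_of_le ?_ (measure_mono (?_ : Ioo (0 : ℝ) 1 ⊆ _))
  · simp
  · intro s hs
    exact ⟨by simpa using (pow_pos hs.1 m), hs⟩

theorem coneBaseMeasure_compl (hK : IsClosed K) :
    coneBaseMeasure K z τ (coneBase K z τ)ᶜ = 0 := by
  refine withDensity_absolutelyContinuous _ _ ?_
  rw [Measure.restrict_apply (measurableSet_coneBase hK).compl, compl_inter_self, measure_empty]

theorem image_conePoint_subset_convexHull {W : Set (EuclideanSpace ℝ (Fin n) × ℝ)}
    (hW : W ⊆ K ×ˢ Ioo (0 : ℝ) 1) : conePoint z '' W ⊆ convexHull ℝ (insert z K) := by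
  rintro _ ⟨p, hp, rfl⟩
  obtain ⟨h1, h2⟩ := hW hp
  exact convex_convexHull ℝ _ (subset_convexHull ℝ _ (mem_insert _ _))
    (subset_convexHull ℝ _ (mem_insert_of_mem _ h1)) (by linarith [h2.2]) h2.1.le (by ring)

theorem coneBase_prod_subset : coneBase K z τ ×ˢ Ioo (0 : ℝ) 1 ⊆ K ×ˢ Ioo (0 : ℝ) 1 :=
  prod_mono (fun _ hx => hx.1) subset_rfl

theorem volume_convexHull_insert_lt_top (hK : IsCompact K) :
    volume (convexHull ℝ (insert z K)) < ∞ :=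
  (isBounded_convexHull.2 (hK.isBounded.insert z)).measure_lt_top

/-- Needed for product measures and Fubini. The local comparison with `a = 2` bounds the base
measure of each piece by the volume of a cone inside the bounded set `[z, K]`, so finite surface
area of `K` need not be known. -/
theorem sigmaFinite_coneBaseMeasure (hK : IsCompact K) (hτ : |τ| = 1) :
    SigmaFinite (coneBaseMeasure K z τ) := by
  have hE : MeasurableSet (coneBase K z τ) := measurableSet_coneBase hK.isClosed
  choose! O hO hcomp using fun (x : EuclideanSpace ℝ (Fin n)) (hx : x ∈ coneBase K z τ) =>
    exists_nhds_volume_image_conePoint_comparison hτ hx (a := 2) (by norm_num)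
  obtain ⟨A, hAm, -, hAO, hcov⟩ := exists_disjoint_measurable_cover O hO
  have hfin : ∀ i, coneBaseMeasure K z τ (coneBase K z τ ∩ A i) < ∞ := by
    intro i
    rcases hAO i with h | ⟨x, hx, hAx⟩
    · simp [h]
    have hsub : coneBase K z τ ∩ A i ⊆ coneBase K z τ := inter_subset_left
    have hm : MeasurableSet (coneBase K z τ ∩ A i) := hE.inter (hAm i)
    have h1 := (hcomp x hx ((coneBase K z τ ∩ A i) ×ˢ Ioo (0 : ℝ) 1)
      (hm.prod measurableSet_Ioo) (prod_mono (inter_subset_inter_right _ hAx) subset_rfl)).2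
    have h2 : ∫⁻ s in Ioo (0 : ℝ) 1, ENNReal.ofReal (s ^ (n - 1)) *
        ∫⁻ x in {x | (x, s) ∈ (coneBase K z τ ∩ A i) ×ˢ Ioo (0 : ℝ) 1},
          ENNReal.ofReal |⟪z - x, outerNormal K x⟫_ℝ| ∂μHE[n - 1] =
        radialMeasure (n - 1) univ * coneBaseMeasure K z τ (coneBase K z τ ∩ A i) := by
      rw [mul_comm, ← lintegral_const, lintegral_radialMeasure _ measurable_const]
      refine setLIntegral_congr_fun measurableSet_Ioo fun s hs => ?_
      have : {x | (x, s) ∈ (coneBase K z τ ∩ A i) ×ˢ Ioo (0 : ℝ) 1} = coneBase K z τ ∩ A i := by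
        ext x
        exact ⟨fun h => h.1, fun h => ⟨h, hs⟩⟩
      simp only [this, coneBaseMeasure_apply hm hsub]
    rw [h2] at h1
    have h3 : volume (conePoint z '' ((coneBase K z τ ∩ A i) ×ˢ Ioo (0 : ℝ) 1)) < ∞ :=
      (measure_mono (image_conePoint_subset_convexHull
        ((prod_mono hsub subset_rfl).trans coneBase_prod_subset))).trans_lt
        (volume_convexHull_insert_lt_top hK)
    refine ENNReal.lt_top_of_mul_ne_top_right (h1.trans_lt ?_).ne (radialMeasure_ne_zero _)
    finiteness
  refine Measure.sigmaFinite_of_countable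
    (S := insert (coneBase K z τ)ᶜ (range fun i => coneBase K z τ ∩ A i))
    ((countable_range _).insert _) ?_ ?_
  · rintro _ (rfl | ⟨i, rfl⟩)
    · rw [coneBaseMeasure_compl hK.isClosed]; simp
    · exact hfin i
  · rw [sUnion_insert, sUnion_range, ← inter_iUnion, inter_eq_self_of_subset_left hcov,
      compl_union_self]

/-- **Cone formula**: the volume of a cone in terms of its base. -/
theorem volume_image_conePoint (hK : IsCompact K) (hτ : |τ| = 1)
    {W : Set (EuclideanSpace ℝ (Fin n) × ℝ)} (hWm : MeasurableSet W)
    (hW : W ⊆ coneBase K z τ ×ˢ Ioo (0 : ℝ) 1) :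
    volume (conePoint z '' W) = (coneBaseMeasure K z τ).prod (radialMeasure (n - 1)) W := by
  have := sigmaFinite_coneBaseMeasure (z := z) hK hτ
  set κ := (coneBaseMeasure K z τ).prod (radialMeasure (n - 1)) with hκ
  have hκW : ∀ S : Set (EuclideanSpace ℝ (Fin n) × ℝ), MeasurableSet S →
      S ⊆ coneBase K z τ ×ˢ Ioo (0 : ℝ) 1 → κ S =
      ∫⁻ s in Ioo (0 : ℝ) 1, ENNReal.ofReal (s ^ (n - 1)) *
        ∫⁻ x in {x | (x, s) ∈ S}, ENNReal.ofReal |⟪z - x, outerNormal K x⟫_ℝ| ∂μHE[n - 1] := by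
    intro S hSm hS
    rw [hκ, Measure.prod_apply_symm hSm,
      lintegral_radialMeasure _ (measurable_measure_prodMk_right hSm)]
    refine lintegral_congr fun s => ?_
    rw [coneBaseMeasure_apply (measurable_prodMk_right hSm) fun x hx => (hS hx).1]
    rfl
  -- The local comparisons carry the same constants on every piece, and the cones over disjoint
  -- pieces are disjoint, so the bounds add up to a global one. Letting `a` decrease to `1` then
  -- gives equality.
  have hlocal : ∀ a : ℝ≥0, 1 < a → volume (conePoint z '' W) ≤ (a : ℝ≥0∞) ^ n * a * κ W ∧
      κ W ≤ (a : ℝ≥0∞) * a ^ (n - 1) * a ^ n * volume (conePoint z '' W) := by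
    intro a ha
    choose! O hO hcomp using fun (x : EuclideanSpace ℝ (Fin n)) (hx : x ∈ coneBase K z τ) =>
      exists_nhds_volume_image_conePoint_comparison hτ hx ha
    obtain ⟨A, hAm, hAd, hAO, hcov⟩ := exists_disjoint_measurable_cover O hO
    set S : ℕ → Set (EuclideanSpace ℝ (Fin n) × ℝ) := fun i => W ∩ (A i ×ˢ univ)
    have hSm : ∀ i, MeasurableSet (S i) := fun i => hWm.inter ((hAm i).prod MeasurableSet.univ)
    have hSW : ∀ i, S i ⊆ W := fun i => inter_subset_left
    have hWS : W = ⋃ i, S i := by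
      rw [← inter_iUnion, ← iUnion_prod_const]
      exact (inter_eq_self_of_subset_left
        fun p hp => mk_mem_prod (hcov (hW hp).1) (mem_univ p.2)).symm
    have hSd : Pairwise (Function.onFun Disjoint S) := fun i j hij =>
      ((Set.disjoint_prod.2 (Or.inl (hAd hij))).inter_left' _).inter_right' _
    have hSi : ∀ i, volume (conePoint z '' S i) ≤ (a : ℝ≥0∞) ^ n * a * κ (S i) ∧
        κ (S i) ≤ (a : ℝ≥0∞) * a ^ (n - 1) * a ^ n * volume (conePoint z '' S i) := by
      intro i
      rw [hκW _ (hSm i) ((hSW i).trans hW)]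
      rcases hAO i with h | ⟨x, hx, hAx⟩
      · simp [S, h]
      · exact hcomp x hx (S i) (hSm i) fun p hp =>
          ⟨⟨(hW hp.1).1, hAx hp.2.1⟩, (hW hp.1).2⟩
    have e1 : κ W = ∑' i, κ (S i) := by
      conv_lhs => rw [hWS]
      exact measure_iUnion hSd hSm
    have e2 : volume (conePoint z '' W) = ∑' i, volume (conePoint z '' S i) := by
      conv_lhs => rw [hWS, image_iUnion]
      refine measure_iUnion (fun i j hij => ?_)
        fun i => measurableSet_image_conePoint (hSm i) ((hSW i).trans hW)
      rw [Function.onFun, Set.disjoint_iff_inter_eq_empty,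
        ← injOn_conePoint_coneBase.image_inter ((hSW i).trans hW) ((hSW j).trans hW),
        Set.disjoint_iff_inter_eq_empty.1 (hSd hij), image_empty]
    rw [e1, e2, ← ENNReal.tsum_mul_left, ← ENNReal.tsum_mul_left]
    exact ⟨ENNReal.tsum_le_tsum fun i => (hSi i).1, ENNReal.tsum_le_tsum fun i => (hSi i).2⟩
  refine le_antisymm (ENNReal.le_of_forall_one_lt_le_pow_mul (n + 1) fun a ha => ?_)
    (ENNReal.le_of_forall_one_lt_le_pow_mul (1 + (n - 1) + n) fun a ha => ?_)
  · rw [pow_succ]; exact (hlocal a ha).1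
  · rw [pow_add, pow_add, pow_one]; exact (hlocal a ha).2

/-- The cone with apex `z` over `coneBase K z τ` in polar coordinates. -/
theorem map_conePoint_prod (hK : IsCompact K) (hτ : |τ| = 1) :
    ((coneBaseMeasure K z τ).prod (radialMeasure (n - 1))).map (conePoint z) =
      volume.restrict (conePoint z '' (coneBase K z τ ×ˢ Ioo (0 : ℝ) 1)) := by
  have := sigmaFinite_coneBaseMeasure (z := z) hK hτ
  have hE : MeasurableSet (coneBase K z τ) := measurableSet_coneBase hK.isClosed
  have hm := (continuous_conePoint z).measurable
  have hD : MeasurableSet (coneBase K z τ ×ˢ Ioo (0 : ℝ) 1) := hE.prod measurableSet_Ioo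
  ext S hS
  rw [Measure.map_apply hm hS, Measure.restrict_apply hS]
  have h0 : (coneBaseMeasure K z τ).prod (radialMeasure (n - 1))
      (coneBase K z τ ×ˢ Ioo (0 : ℝ) 1)ᶜ = 0 := by
    rw [compl_prod_eq_union]
    refine measure_union_null ?_ ?_
    · rw [Measure.prod_prod, coneBaseMeasure_compl hK.isClosed, zero_mul]
    · rw [Measure.prod_prod]
      have : radialMeasure (n - 1) (Ioo (0 : ℝ) 1)ᶜ = 0 := by
        refine withDensity_absolutelyContinuous _ _ ?_
        rw [Measure.restrict_apply measurableSet_Ioo.compl, compl_inter_self, measure_empty]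
      rw [this, mul_zero]
  have h1 : (coneBaseMeasure K z τ).prod (radialMeasure (n - 1))
      (conePoint z ⁻¹' S \ coneBase K z τ ×ˢ Ioo (0 : ℝ) 1) = 0 :=
    measure_mono_null (fun p hp => hp.2) h0
  rw [← measure_inter_add_sdiff (conePoint z ⁻¹' S) hD, h1, add_zero, ← volume_image_conePoint hK hτ ((hm hS).inter hD) inter_subset_right,
    image_preimage_inter]

end ConeMeasure

/-! ### The cones fill the hull up to null sets, and the hull varies continuously. -/

section Covering

variable {n : ℕ} {K : Set (EuclideanSpace ℝ (Fin n))} {z : EuclideanSpace ℝ (Fin n)} {τ : ℝ}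

theorem IsOuterUnitNormal.notMem_interior {x u : EuclideanSpace ℝ (Fin n)}
    (h : IsOuterUnitNormal K x u) : x ∉ interior K := by
  intro hx
  have hc : Tendsto (fun t : ℝ => x + t • u) (𝓝[>] 0) (𝓝 x) := by
    have : Continuous fun t : ℝ => x + t • u := by fun_prop
    simpa using (this.tendsto 0).mono_left nhdsWithin_le_nhds
  obtain ⟨t, ht, ht0⟩ := ((hc.eventually (mem_interior_iff_mem_nhds.1 hx)).and
    self_mem_nhdsWithin).exists
  have := h.2 _ ht
  rw [add_sub_cancel_left, inner_smul_left, real_inner_self_eq_norm_sq, h.1] at this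
  simp at this
  exact absurd this (not_le.2 ht0)

/-- Opposite normals would put `K` in a hyperplane. -/
theorem IsOuterUnitNormal.not_neg (hint : (interior K).Nonempty) {x u : EuclideanSpace ℝ (Fin n)}
    (h : IsOuterUnitNormal K x u) : ¬ IsOuterUnitNormal K x (-u) := by
  intro h'
  obtain ⟨y, hy⟩ := hint
  have h1 : ∀ k ∈ K, ⟪k - x, u⟫_ℝ = 0 := fun k hk => by
    have := h'.2 k hk
    rw [inner_neg_right] at this
    linarith [h.2 k hk]
  refine IsOuterUnitNormal.notMem_interior (K := K) (x := y) (u := u) ⟨h.1, fun k hk => ?_⟩ hy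
  rw [show k - y = (k - x) - (y - x) by abel, inner_sub_left, h1 k hk, h1 y (interior_subset hy),
    sub_zero]

theorem exists_norm_eq_one_inner {f : StrongDual ℝ (EuclideanSpace ℝ (Fin n))} (hf : f ≠ 0) :
    ∃ u : EuclideanSpace ℝ (Fin n), ‖u‖ = 1 ∧ ∃ c : ℝ, 0 < c ∧ ∀ y, ⟪y, u⟫_ℝ = c * f y := by
  set w := (InnerProductSpace.toDual ℝ _).symm f with hw
  have hw0 : w ≠ 0 := by simpa [hw] using hf
  have hpos := norm_pos_iff.2 hw0
  refine ⟨‖w‖⁻¹ • w, ?_, ‖w‖⁻¹, by positivity, fun y => ?_⟩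
  · rw [norm_smul, norm_inv, norm_norm, inv_mul_cancel₀ hpos.ne']
  · rw [inner_smul_right, real_inner_comm, hw, InnerProductSpace.toDual_symm_apply]

/-- A convex set disjoint from `K` which is adherent to `x ∈ K` is separated from `K` by a
supporting hyperplane at `x`. -/
theorem exists_isOuterUnitNormal_of_disjoint (hconv : Convex ℝ K) (hint : (interior K).Nonempty)
    {R : Set (EuclideanSpace ℝ (Fin n))} (hR : Convex ℝ R) (hdisj : Disjoint K R)
    {x : EuclideanSpace ℝ (Fin n)} (hx : x ∈ K) (hxR : x ∈ closure R) :
    ∃ u, IsOuterUnitNormal K x u ∧ ∀ r ∈ R, 0 ≤ ⟪r - x, u⟫_ℝ := by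
  obtain ⟨f, c, hf, hK, hRc⟩ := geometric_hahn_banach_of_nonempty_interior hconv hR
    (hdisj.mono_left interior_subset) hint (closure_nonempty_iff.1 ⟨x, hxR⟩)
  have hxc : f x = c := le_antisymm (hK x hx)
    (closure_minimal (fun r hr => hRc r hr) (isClosed_le continuous_const f.continuous) hxR)
  obtain ⟨u, hu, b, hb, hfu⟩ := exists_norm_eq_one_inner hf
  refine ⟨u, ⟨hu, fun y hy => ?_⟩, fun r hr => ?_⟩
  · rw [hfu, map_sub, hxc]
    exact mul_nonpos_of_nonneg_of_nonpos hb.le (by linarith [hK y hy])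
  · rw [hfu, map_sub, hxc]
    exact mul_nonneg hb.le (by linarith [hRc r hr])

/-- The supporting hyperplanes at `x`, written as `⟪y - z, w⟫ = τ`, are not unique. -/
def HasTwoSupports (K : Set (EuclideanSpace ℝ (Fin n))) (z : EuclideanSpace ℝ (Fin n)) (τ : ℝ)
    (x : EuclideanSpace ℝ (Fin n)) : Prop :=
  ∃ w₁ w₂ : EuclideanSpace ℝ (Fin n), w₁ ≠ w₂ ∧
    (∀ k ∈ K, ⟪k - z, w₁⟫_ℝ ≤ τ) ∧ (∀ k ∈ K, ⟪k - z, w₂⟫_ℝ ≤ τ) ∧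
    ⟪x - z, w₁⟫_ℝ = τ ∧ ⟪x - z, w₂⟫_ℝ = τ

/-- A tangential `u` and the vector `0` are two supports with right-hand side `0`. Otherwise a
multiple of `u` has right-hand side `τ`, and a second normal `u₂` yields another. As `⟪x - z, u₂⟫`
may vanish or have the wrong sign, `u₂` cannot simply be rescaled and is mixed with `u`. -/
theorem mem_coneBase_or_hasTwoSupports (hint : (interior K).Nonempty) (hτ : |τ| = 1)
    {x u : EuclideanSpace ℝ (Fin n)} (hx : x ∈ K) (hu : IsOuterUnitNormal K x u)
    (hxu : 0 ≤ τ * ⟪x - z, u⟫_ℝ) :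
    x ∈ coneBase K z τ ∨ HasTwoSupports K z τ x ∨ HasTwoSupports K z 0 x := by
  have hsplit : ∀ k w, ⟪k - z, w⟫_ℝ = ⟪k - x, w⟫_ℝ + ⟪x - z, w⟫_ℝ := fun k w => by
    rw [← inner_add_left]; congr 1; abel
  have hττ : τ * τ = 1 := by rw [← abs_mul_abs_self, hτ, one_mul]
  have hτ0 : τ ≠ 0 := by rintro rfl; simp at hτ
  have hu0 : u ≠ 0 := by rintro rfl; simpa using hu.1
  rcases hxu.eq_or_lt with h0 | hpos
  · have h0' : ⟪x - z, u⟫_ℝ = 0 := (mul_eq_zero.1 h0.symm).resolve_left hτ0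
    refine Or.inr (Or.inr ⟨u, 0, hu0, fun k hk => ?_, by simp, h0', by simp⟩)
    rw [hsplit, h0', add_zero]
    exact hu.2 k hk
  by_cases hex : ∃! u, IsOuterUnitNormal K x u
  · left
    refine ⟨hx, ⟨subset_closure hx, hu.notMem_interior⟩, hex, ?_⟩
    rwa [hex.unique (outerNormal_spec hex) hu]
  right; left
  obtain ⟨u₂, hu₂, hne⟩ : ∃ u₂, IsOuterUnitNormal K x u₂ ∧ u₂ ≠ u := by
    by_contra! h
    exact hex ⟨u, hu, h⟩
  set p := τ * ⟪x - z, u⟫_ℝ with hp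
  set q := ⟪x - z, u₂⟫_ℝ with hq
  have hpu : ⟪x - z, u⟫_ℝ = τ * p := by rw [hp, ← mul_assoc, hττ, one_mul]
  -- Small enough that the coefficient `1 - τ l q` is nonnegative; that coefficient is forced by the
  -- value `τ` at `x`.
  set l : ℝ := 1 / (1 + |q|) with hl
  have hl0 : 0 < l := by positivity
  have hcoef : 0 ≤ 1 - τ * l * q := by
    have h1 : |τ * l * q| ≤ 1 := by
      rw [abs_mul, abs_mul, hτ, one_mul, abs_of_pos hl0, hl, one_div_mul_eq_div,
        div_le_one (by positivity)]
      linarith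
    linarith [le_abs_self (τ * l * q)]
  have hw₁ : ⟪x - z, p⁻¹ • u⟫_ℝ = τ := by
    rw [inner_smul_right, hpu]; field_simp
  have hk₁ : ∀ k ∈ K, ⟪k - x, p⁻¹ • u⟫_ℝ ≤ 0 := fun k hk => by
    rw [inner_smul_right]
    exact mul_nonpos_of_nonneg_of_nonpos (by positivity) (hu.2 k hk)
  refine ⟨p⁻¹ • u, (1 - τ * l * q) • (p⁻¹ • u) + l • u₂, ?_, fun k hk => ?_, fun k hk => ?_,
    hw₁, ?_⟩
  · intro h
    have h1 : l • u₂ = l • ((τ * q * p⁻¹) • u) := by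
      have : l • u₂ = p⁻¹ • u - (1 - τ * l * q) • (p⁻¹ • u) := by
        nth_rewrite 1 [h]; abel
      rw [this]; module
    have h2 := smul_right_injective _ hl0.ne' h1
    have h3 : |τ * q * p⁻¹| = 1 := by
      have := congrArg norm h2
      simp only [norm_smul, hu.1, hu₂.1, mul_one, Real.norm_eq_abs] at this
      exact this.symm
    rcases (abs_eq one_pos.le).1 h3 with h4 | h4
    · simp only [h4, one_smul] at h2
      exact hne h2
    · simp only [h4, neg_smul, one_smul] at h2
      exact hu.not_neg hint (h2 ▸ hu₂)
  · rw [hsplit, hw₁]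
    linarith [hk₁ k hk]
  · rw [hsplit, inner_add_right, inner_add_right, inner_smul_right _ _ (1 - τ * l * q),
      inner_smul_right _ _ (1 - τ * l * q), inner_smul_right _ _ l, inner_smul_right _ _ l, hw₁]
    have h1 := mul_nonpos_of_nonneg_of_nonpos hcoef (hk₁ k hk)
    have h2 := mul_nonpos_of_nonneg_of_nonpos hl0.le (hu₂.2 k hk)
    have h3 : (1 - τ * l * q) * τ + l * q = τ := by linear_combination (-l * q) * hττ
    linarith
  · rw [inner_add_right, inner_smul_right _ _ (1 - τ * l * q), inner_smul_right _ _ l, hw₁]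
    linear_combination (-l * q) * hττ

theorem mem_convexHull_insert_iff (hconv : Convex ℝ K) (hne : K.Nonempty)
    {y : EuclideanSpace ℝ (Fin n)} : y ∈ convexHull ℝ (insert z K) ↔
      ∃ p ∈ K ×ˢ Icc (0 : ℝ) 1, conePoint z p = y := by
  rw [convexHull_insert hne, hconv.convexHull_eq, convexJoin_singleton_left]
  simp only [mem_iUnion, segment_eq_image, conePoint]
  constructor
  · rintro ⟨k, hk, s, hs, rfl⟩
    exact ⟨(k, s), ⟨hk, hs⟩, rfl⟩
  · rintro ⟨⟨k, s⟩, ⟨hk, hs⟩, rfl⟩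
    exact ⟨k, hk, s, hs, rfl⟩

/-- The parameters at which the ray from `z` through `y` meets `K` beyond `y`. -/
theorem isCompact_setOf_lineMap_mem (hK : IsCompact K) {y : EuclideanSpace ℝ (Fin n)}
    (hy : y ≠ z) : IsCompact {t : ℝ | 1 ≤ t ∧ AffineMap.lineMap z y t ∈ K} := by
  refine Metric.isCompact_of_isClosed_isBounded ?_ ?_
  · exact (isClosed_le continuous_const continuous_id).inter
      (hK.isClosed.preimage (AffineMap.lineMap_continuous (p := z) (q := y)))
  · obtain ⟨C, hC⟩ := hK.isBounded.subset_closedBall z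
    have hpos : 0 < ‖y - z‖ := norm_pos_iff.2 (sub_ne_zero.2 hy)
    refine (Metric.isBounded_Icc 1 (C / ‖y - z‖)).subset ?_
    rintro t ⟨ht1, ht⟩
    refine ⟨ht1, (le_div_iff₀ hpos).2 ?_⟩
    have := hC ht
    rw [mem_closedBall_iff_norm, AffineMap.lineMap_apply] at this
    simpa [norm_smul, abs_of_pos (zero_lt_one.trans_le ht1)] using this

theorem conePoint_lineMap {y : EuclideanSpace ℝ (Fin n)} {t : ℝ} (ht : t ≠ 0) :
    conePoint z (AffineMap.lineMap z y t, t⁻¹) = y := by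
  rw [conePoint_eq, AffineMap.lineMap_apply]
  simp [smul_smul, ht]

theorem exists_lineMap_mem (hconv : Convex ℝ K) (hne : K.Nonempty)
    {y : EuclideanSpace ℝ (Fin n)} (hy : y ∈ convexHull ℝ (insert z K)) (hyz : y ≠ z) :
    {t : ℝ | 1 ≤ t ∧ AffineMap.lineMap z y t ∈ K}.Nonempty := by
  obtain ⟨⟨k, s⟩, ⟨hk, hs⟩, rfl⟩ := (mem_convexHull_insert_iff hconv hne).1 hy
  have hs0 : s ≠ 0 := by
    rintro rfl
    simp [conePoint] at hyz
  have hspos : 0 < s := lt_of_le_of_ne hs.1 hs0.symm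
  refine ⟨s⁻¹, (one_le_inv₀ hspos).2 hs.2, ?_⟩
  have : AffineMap.lineMap z (conePoint z (k, s)) s⁻¹ = k := by
    rw [conePoint_eq, AffineMap.lineMap_apply]
    simp [smul_smul, hs0]
  rwa [this]

/-- Hahn–Banach separates `K` from the part of the line over `I`, which misses `K` but adheres to
the point at `t₀`. The side of `t₀` on which `I` lies decides the sign of `⟪y - z, u⟫`. -/
theorem exists_normal_of_lineMap (hconv : Convex ℝ K) (hint : (interior K).Nonempty)
    {y : EuclideanSpace ℝ (Fin n)} {t₀ : ℝ} {I : Set ℝ} (hI : Convex ℝ I) (ht₀ : t₀ ∈ closure I)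
    (hIK : ∀ t ∈ I, AffineMap.lineMap z y t ∉ K) (hx : AffineMap.lineMap z y t₀ ∈ K) :
    ∃ u, IsOuterUnitNormal K (AffineMap.lineMap z y t₀) u ∧
      ∀ t ∈ I, 0 ≤ (t - t₀) * ⟪y - z, u⟫_ℝ := by
  obtain ⟨u, hu, hr⟩ := exists_isOuterUnitNormal_of_disjoint hconv hint
    (hI.affine_image (AffineMap.lineMap z y)) (Set.disjoint_left.2 (by
      rintro _ hk ⟨t, ht, rfl⟩; exact hIK t ht hk)) hx
    (image_closure_subset_closure_image AffineMap.lineMap_continuous (mem_image_of_mem _ ht₀))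
  refine ⟨u, hu, fun t ht => ?_⟩
  have := hr _ (mem_image_of_mem _ ht)
  rw [AffineMap.lineMap_apply, AffineMap.lineMap_apply] at this
  have e : (t • (y -ᵥ z) +ᵥ z) - (t₀ • (y -ᵥ z) +ᵥ z) = (t - t₀) • (y - z) := by
    simp only [vsub_eq_sub, vadd_eq_add]; module
  rwa [e, inner_smul_left] at this

theorem exists_exit_point (hK : IsCompact K) (hconv : Convex ℝ K) (hint : (interior K).Nonempty)
    {y : EuclideanSpace ℝ (Fin n)} (hy : y ∈ convexHull ℝ (insert z K)) (hyz : y ≠ z)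
    (hyK : y ∉ frontier K) : ∃ x ∈ K, ∃ s ∈ Ioo (0 : ℝ) 1, y = conePoint z (x, s) ∧
      ∃ u, IsOuterUnitNormal K x u ∧ 0 ≤ 1 * ⟪x - z, u⟫_ℝ := by
  obtain ⟨t₀, ⟨ht1, ht⟩, hmax⟩ := (isCompact_setOf_lineMap_mem hK hyz).exists_isGreatest
    (exists_lineMap_mem hconv (hint.mono interior_subset) hy hyz)
  obtain ⟨u, hu, hI⟩ := exists_normal_of_lineMap (I := Ioi t₀) hconv hint (convex_Ioi t₀)
    (by rw [closure_Ioi]; exact self_mem_Ici)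
    (fun t htt htK => absurd (hmax ⟨ht1.trans (le_of_lt htt), htK⟩) (not_le.2 htt)) ht
  -- For `t₀ = 1` the point `y` itself would be the exit point, hence on the boundary of `K`.
  have ht1' : t₀ ≠ 1 := by
    rintro rfl
    rw [AffineMap.lineMap_apply_one] at ht hu
    exact hyK ⟨subset_closure ht, hu.notMem_interior⟩
  have ht2 : 1 < t₀ := lt_of_le_of_ne ht1 ht1'.symm
  refine ⟨_, ht, t₀⁻¹, ⟨by positivity, inv_lt_one_of_one_lt₀ ht2⟩,
    (conePoint_lineMap (by positivity)).symm, u, hu, ?_⟩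
  have := hI (t₀ + 1) (by simp)
  rw [add_sub_cancel_left, one_mul] at this
  rw [AffineMap.lineMap_apply, vadd_eq_add, add_sub_cancel_right, inner_smul_left, one_mul]
  exact mul_nonneg (by simp; linarith) this

theorem exists_entry_point (hK : IsCompact K) (hconv : Convex ℝ K) (hint : (interior K).Nonempty)
    {y : EuclideanSpace ℝ (Fin n)} (hy : y ∈ convexHull ℝ (insert z K)) (hyz : y ≠ z)
    (hyK : y ∉ K) : ∃ x ∈ K, ∃ s ∈ Ioo (0 : ℝ) 1, y = conePoint z (x, s) ∧
      ∃ u, IsOuterUnitNormal K x u ∧ 0 ≤ (-1) * ⟪x - z, u⟫_ℝ := by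
  obtain ⟨t₀, ⟨ht1, ht⟩, hmin⟩ := (isCompact_setOf_lineMap_mem hK hyz).exists_isLeast
    (exists_lineMap_mem hconv (hint.mono interior_subset) hy hyz)
  have ht1' : t₀ ≠ 1 := by
    rintro rfl
    rw [AffineMap.lineMap_apply_one] at ht
    exact hyK ht
  have ht2 : 1 < t₀ := lt_of_le_of_ne ht1 ht1'.symm
  -- The segment from `y` up to the first point in `K` plays the role of the outer ray at an exit
  -- point, with the opposite sign.
  obtain ⟨u, hu, hI⟩ := exists_normal_of_lineMap (I := Ico 1 t₀) hconv hint (convex_Ico 1 t₀)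
    (by rw [closure_Ico ht1'.symm]; exact ⟨ht1, le_rfl⟩)
    (fun t htt htK => absurd (hmin ⟨htt.1, htK⟩) (not_le.2 htt.2)) ht
  refine ⟨_, ht, t₀⁻¹, ⟨by positivity, inv_lt_one_of_one_lt₀ ht2⟩,
    (conePoint_lineMap (by positivity)).symm, u, hu, ?_⟩
  have := hI 1 ⟨le_rfl, ht2⟩
  have h2 : ⟪y - z, u⟫_ℝ ≤ 0 := by nlinarith
  rw [AffineMap.lineMap_apply, vadd_eq_add, add_sub_cancel_right, inner_smul_left, neg_one_mul,
    neg_nonneg]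
  exact mul_nonpos_of_nonneg_of_nonpos (by simp; linarith) h2

theorem volume_hasTwoSupports :
    volume {y : EuclideanSpace ℝ (Fin n) | ∃ x ∈ K, ∃ s : ℝ, 0 ≤ s ∧ y = conePoint z (x, s) ∧
      HasTwoSupports K z τ x} = 0 :=
  measure_conePoint_two_supports_eq_zero K z τ

theorem image_conePoint_ae_eq_convexHull (hn : 1 ≤ n) (hK : IsCompact K) (hconv : Convex ℝ K)
    (hint : (interior K).Nonempty) :
    conePoint z '' (coneBase K z 1 ×ˢ Ioo (0 : ℝ) 1) =ᵐ[volume] convexHull ℝ (insert z K) := by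
  -- Positive dimension makes the apex a null set.
  have : Nonempty (Fin n) := ⟨⟨0, hn⟩⟩
  refine (image_conePoint_subset_convexHull coneBase_prod_subset).eventuallyLE.antisymm ?_
  rw [ae_le_set]
  refine measure_mono_null (t := ({z} ∪ frontier K) ∪
    ({y | ∃ x ∈ K, ∃ s : ℝ, 0 ≤ s ∧ y = conePoint z (x, s) ∧ HasTwoSupports K z 1 x} ∪
    {y | ∃ x ∈ K, ∃ s : ℝ, 0 ≤ s ∧ y = conePoint z (x, s) ∧ HasTwoSupports K z 0 x})) ?_
    (measure_union_null (measure_union_null (measure_singleton z) (hconv.addHaar_frontier _))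
      (measure_union_null volume_hasTwoSupports volume_hasTwoSupports))
  rintro y ⟨hy, hyD⟩
  by_contra hcon
  simp only [mem_union, not_or] at hcon
  obtain ⟨⟨hyz, hyf⟩, hy1, hy0⟩ := hcon
  obtain ⟨x, hx, s, hs, hys, u, hu, hxu⟩ := exists_exit_point hK hconv hint hy hyz hyf
  rcases mem_coneBase_or_hasTwoSupports hint abs_one hx hu hxu with h | h | h
  · exact hyD ⟨(x, s), ⟨h, hs⟩, hys.symm⟩
  · exact hy1 ⟨x, hx, s, hs.1.le, hys, h⟩
  · exact hy0 ⟨x, hx, s, hs.1.le, hys, h⟩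

theorem image_conePoint_ae_eq_convexHull_diff (hn : 1 ≤ n) (hK : IsCompact K)
    (hconv : Convex ℝ K) (hint : (interior K).Nonempty) :
    conePoint z '' (coneBase K z (-1) ×ˢ Ioo (0 : ℝ) 1) =ᵐ[volume]
      (convexHull ℝ (insert z K) \ K : Set (EuclideanSpace ℝ (Fin n))) := by
  have : Nonempty (Fin n) := ⟨⟨0, hn⟩⟩
  have hsub : conePoint z '' (coneBase K z (-1) ×ˢ Ioo (0 : ℝ) 1) ⊆
      convexHull ℝ (insert z K) \ K := by
    refine fun y hy => ⟨image_conePoint_subset_convexHull coneBase_prod_subset hy, ?_⟩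
    obtain ⟨⟨x, s⟩, ⟨hx, hs⟩, rfl⟩ := hy
    intro hyK
    -- For negative sign, moving from `x` towards `z` crosses the supporting hyperplane at `x`, so
    -- the cone avoids `K`.
    have h1 := (outerNormal_spec hx.2.2.1).2 _ hyK
    have e : conePoint z (x, s) - x = -((1 - s) • (x - z)) := by unfold conePoint; module
    rw [e, inner_neg_left, inner_smul_left] at h1
    have h2 := hx.2.2.2
    have h3 : 0 < 1 - s := by linarith [hs.2]
    simp only [conj_trivial] at h1
    nlinarith
  refine hsub.eventuallyLE.antisymm ?_
  rw [ae_le_set]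
  refine measure_mono_null (t := {z} ∪
    ({y | ∃ x ∈ K, ∃ s : ℝ, 0 ≤ s ∧ y = conePoint z (x, s) ∧ HasTwoSupports K z (-1) x} ∪
    {y | ∃ x ∈ K, ∃ s : ℝ, 0 ≤ s ∧ y = conePoint z (x, s) ∧ HasTwoSupports K z 0 x})) ?_
    (measure_union_null (measure_singleton z)
      (measure_union_null volume_hasTwoSupports volume_hasTwoSupports))
  rintro y ⟨⟨hy, hyK⟩, hyD⟩
  by_contra hcon
  simp only [mem_union, not_or] at hcon
  obtain ⟨hyz, hy1, hy0⟩ := hcon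
  obtain ⟨x, hx, s, hs, hys, u, hu, hxu⟩ := exists_entry_point hK hconv hint hy hyz hyK
  rcases mem_coneBase_or_hasTwoSupports hint (by simp) hx hu hxu with h | h | h
  · exact hyD ⟨(x, s), ⟨h, hs⟩, hys.symm⟩
  · exact hy1 ⟨x, hx, s, hs.1.le, hys, h⟩
  · exact hy0 ⟨x, hx, s, hs.1.le, hys, h⟩

/-- Off the boundary of `[z₀, K]`, membership in `[z, K]` is locally constant in `z`. -/
theorem eventually_mem_convexHull_insert_iff (hK : IsCompact K) (hconv : Convex ℝ K)
    (hint : (interior K).Nonempty) {z₀ y : EuclideanSpace ℝ (Fin n)}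
    (hy : y ∉ frontier (convexHull ℝ (insert z₀ K))) :
    ∀ᶠ z in 𝓝 z₀, (y ∈ convexHull ℝ (insert z K) ↔ y ∈ convexHull ℝ (insert z₀ K)) := by
  have hne : K.Nonempty := hint.mono interior_subset
  by_cases hy₀ : y ∈ convexHull ℝ (insert z₀ K)
  · have hyint : y ∈ interior (convexHull ℝ (insert z₀ K)) := by
      by_contra h
      exact hy ⟨subset_closure hy₀, h⟩
    -- A hyperplane through `y` with `K` and `z` on one side is a closed condition on `z`, as unit
    -- normals form a compact set. It fails at `z₀` because `y` is interior, hence it fails nearby.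
    have hcl : IsClosed {z | ∃ w ∈ Metric.sphere (0 : EuclideanSpace ℝ (Fin n)) 1, (z, w) ∈
        {p : EuclideanSpace ℝ (Fin n) × EuclideanSpace ℝ (Fin n) |
          ⟪p.1 - y, p.2⟫_ℝ ≤ 0 ∧ ∀ k ∈ K, ⟪k - y, p.2⟫_ℝ ≤ 0}} := by
      refine (isCompact_sphere _ _).isClosed_setOf_exists_mem ?_
      refine (isClosed_le (f := fun p : EuclideanSpace ℝ (Fin n) × EuclideanSpace ℝ (Fin n) =>
        ⟪p.1 - y, p.2⟫_ℝ) (by fun_prop) continuous_const).inter ?_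
      have : {p : EuclideanSpace ℝ (Fin n) × EuclideanSpace ℝ (Fin n) |
          ∀ k ∈ K, ⟪k - y, p.2⟫_ℝ ≤ 0} = ⋂ k ∈ K, {p | ⟪k - y, p.2⟫_ℝ ≤ 0} := by
        ext p; simp
      change IsClosed {p : EuclideanSpace ℝ (Fin n) × EuclideanSpace ℝ (Fin n) |
          ∀ k ∈ K, ⟪k - y, p.2⟫_ℝ ≤ 0}
      rw [this]
      exact isClosed_biInter fun k _ => isClosed_le (by fun_prop) (by fun_prop)
    filter_upwards [hcl.isOpen_compl.mem_nhds (x := z₀) (by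
      rintro ⟨w, hw, hw1, hw2⟩
      refine IsOuterUnitNormal.notMem_interior (K := convexHull ℝ (insert z₀ K)) (x := y) (u := w)
        ⟨by simpa using hw, fun k hk => ?_⟩ hyint
      have hcv : Convex ℝ {k : EuclideanSpace ℝ (Fin n) | ⟪w, k⟫_ℝ ≤ ⟪w, y⟫_ℝ} :=
        convex_halfSpace_le (innerSL ℝ w).toLinearMap.isLinear _
      have h1 : ∀ k, ⟪k - y, w⟫_ℝ ≤ 0 ↔ ⟪w, k⟫_ℝ ≤ ⟪w, y⟫_ℝ := fun k => by
        rw [inner_sub_left, sub_nonpos, real_inner_comm, real_inner_comm y]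
      refine (h1 k).2 (convexHull_min (insert_subset ?_ fun k hk => ?_) hcv hk)
      · exact (h1 _).1 hw1
      · exact (h1 _).1 (hw2 k hk))] with z hz
    refine iff_of_true ?_ hy₀
    by_contra hyz
    obtain ⟨f, hf, hfy⟩ := geometric_hahn_banach_of_nonempty_interior_point
      (convex_convexHull ℝ (insert z K)) (fun h => hyz (interior_subset h))
      (hint.mono (interior_mono ((subset_insert z K).trans (subset_convexHull ℝ _))))
    obtain ⟨u, hu, b, hb, hfu⟩ := exists_norm_eq_one_inner hf
    have hle : ∀ k ∈ convexHull ℝ (insert z K), ⟪k - y, u⟫_ℝ ≤ 0 := fun k hk => by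
      rw [hfu, map_sub]
      exact mul_nonpos_of_nonneg_of_nonpos hb.le (by linarith [hfy k hk])
    exact hz ⟨u, by simpa using hu, hle z (subset_convexHull ℝ _ (mem_insert _ _)),
      fun k hk => hle k (subset_convexHull ℝ _ (mem_insert_of_mem _ hk))⟩
  · have hcl : IsClosed {z | ∃ p ∈ K ×ˢ Icc (0 : ℝ) 1, (z, p) ∈
        {q : EuclideanSpace ℝ (Fin n) × (EuclideanSpace ℝ (Fin n) × ℝ) |
          conePoint q.1 q.2 = y}} := by
      refine (hK.prod isCompact_Icc).isClosed_setOf_exists_mem (isClosed_eq ?_ continuous_const)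
      unfold conePoint; fun_prop
    filter_upwards [hcl.isOpen_compl.mem_nhds (x := z₀)
      (fun h => hy₀ ((mem_convexHull_insert_iff hconv hne).2 h))] with z hz
    exact iff_of_false (fun h => hz ((mem_convexHull_insert_iff hconv hne).1 h)) hy₀

end Covering

/-! ### From the cone formula to the boundary integral. -/

section Integration

variable {n : ℕ} {K : Set (EuclideanSpace ℝ (Fin n))} {z : EuclideanSpace ℝ (Fin n)} {τ : ℝ}

theorem integrable_radialMeasure_iff {m : ℕ} {g : ℝ → ℝ} :
    Integrable g (radialMeasure m) ↔ IntervalIntegrable (fun s => g s * s ^ m) volume 0 1 := by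
  rw [radialMeasure, integrable_withDensity_iff_integrable_smul' (by fun_prop) (by simp),
    intervalIntegrable_iff_integrableOn_Ioo_of_le zero_le_one]
  refine integrable_congr ?_
  filter_upwards [ae_restrict_mem measurableSet_Ioo] with s hs
  rw [ENNReal.toReal_ofReal (pow_nonneg hs.1.le m), smul_eq_mul, mul_comm]

theorem integral_radialMeasure {m : ℕ} {g : ℝ → ℝ} :
    ∫ s, g s ∂radialMeasure m = ∫ s in (0 : ℝ)..1, g s * s ^ m := by
  rw [radialMeasure, integral_withDensity_eq_integral_toReal_smul (by fun_prop) (by simp),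
    intervalIntegral.integral_of_le zero_le_one, integral_Ioc_eq_integral_Ioo]
  refine setIntegral_congr_fun measurableSet_Ioo fun s hs => ?_
  simp only [ENNReal.toReal_ofReal (pow_nonneg hs.1.le m), smul_eq_mul, mul_comm]

theorem aemeasurable_coneBase_density (hK : IsClosed K) :
    AEMeasurable (fun x => ENNReal.ofReal |⟪z - x, outerNormal K x⟫_ℝ|)
      (μHE[n - 1].restrict (coneBase K z τ)) := by
  have hc : ContinuousOn (fun x => ⟪z - x, outerNormal K x⟫_ℝ) (coneBase K z τ) :=
    ContinuousOn.inner (by fun_prop) (continuousOn_outerNormal.mono fun x hx => hx.2.2.1)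
  exact ((hc.aemeasurable (measurableSet_coneBase hK)).abs).ennreal_ofReal

/-- Integration over a cone in polar coordinates. -/
theorem integral_cone (hK : IsCompact K) (hτ : |τ| = 1) {f : EuclideanSpace ℝ (Fin n) → ℝ}
    (hf : Integrable f) :
    (∀ᵐ x ∂(μHE[n - 1].restrict (coneBase K z τ)),
      IntervalIntegrable (fun s : ℝ => f ((1 - s) • z + s • x) * s ^ (n - 1)) volume 0 1) ∧
    IntegrableOn (fun x => |⟪z - x, outerNormal K x⟫_ℝ| *
      ∫ s in (0 : ℝ)..1, f ((1 - s) • z + s • x) * s ^ (n - 1)) (coneBase K z τ) μHE[n - 1] ∧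
    ∫ x in coneBase K z τ, |⟪z - x, outerNormal K x⟫_ℝ| *
      (∫ s in (0 : ℝ)..1, f ((1 - s) • z + s • x) * s ^ (n - 1)) ∂μHE[n - 1] =
      ∫ y in conePoint z '' (coneBase K z τ ×ˢ Ioo (0 : ℝ) 1), f y := by
  have := sigmaFinite_coneBaseMeasure (z := z) hK hτ
  have hE : MeasurableSet (coneBase K z τ) := measurableSet_coneBase hK.isClosed
  have hd := aemeasurable_coneBase_density (z := z) (τ := τ) hK.isClosed
  have hmap := map_conePoint_prod (z := z) hK hτ
  have hG := (continuous_conePoint z).measurable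
  have hint : Integrable f (((coneBaseMeasure K z τ).prod (radialMeasure (n - 1))).map
      (conePoint z)) := by
    rw [hmap]; exact hf.restrict
  have hint' := hint.comp_measurable hG
  have hlt : ∀ᵐ x ∂(μHE[n - 1].restrict (coneBase K z τ)),
      ENNReal.ofReal |⟪z - x, outerNormal K x⟫_ℝ| < ∞ := by simp
  refine ⟨?_, ?_, ?_⟩
  · have h1 := hint'.prod_right_ae
    rw [coneBaseMeasure, ae_withDensity_iff' hd] at h1
    filter_upwards [h1, ae_restrict_mem hE] with x hx hxE
    refine integrable_radialMeasure_iff.1 (hx ?_)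
    rw [abs_inner_outerNormal_of_mem_coneBase hτ hxE, ENNReal.ofReal_ne_zero_iff]
    exact hxE.2.2.2
  · have h1 := hint'.integral_prod_left
    rw [coneBaseMeasure, integrable_withDensity_iff_integrable_smul₀' hd hlt] at h1
    simpa only [ENNReal.toReal_ofReal (abs_nonneg _), smul_eq_mul, integral_radialMeasure,
      Function.comp_apply, conePoint, IntegrableOn] using h1
  · rw [← hmap, integral_map hG.aemeasurable hint.1,
      integral_prod (fun p => f (conePoint z p)) hint', coneBaseMeasure,
      integral_withDensity_eq_integral_toReal_smul₀ hd hlt]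
    simp only [ENNReal.toReal_ofReal (abs_nonneg _), smul_eq_mul, integral_radialMeasure,
      conePoint]

/-- `outerNormal` is `0` where the normal is not unique, so such points contribute nothing to the
boundary integral; that they form an `(n-1)`-null set is not needed. -/
theorem mem_coneBase_of_inner_ne_zero (hK : IsClosed K) {x : EuclideanSpace ℝ (Fin n)}
    (hx : x ∈ frontier K) (h : ⟪z - x, outerNormal K x⟫_ℝ ≠ 0) :
    x ∈ coneBase K z 1 ∪ coneBase K z (-1) := by
  have hex : ∃! u, IsOuterUnitNormal K x u := by
    by_contra hcon
    refine h ?_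
    rw [outerNormal, dif_neg hcon, inner_zero_right]
  have h' : ⟪x - z, outerNormal K x⟫_ℝ ≠ 0 := by
    rw [← neg_sub z x, inner_neg_left]; simpa using h
  rcases h'.lt_or_gt with h1 | h1
  · exact Or.inr ⟨hK.frontier_subset hx, hx, hex, by linarith⟩
  · exact Or.inl ⟨hK.frontier_subset hx, hx, hex, by linarith⟩

theorem disjoint_coneBase : Disjoint (coneBase K z 1) (coneBase K z (-1)) := by
  rw [Set.disjoint_left]
  intro x h1 h2
  linarith [h1.2.2.2, h2.2.2.2]

theorem coneBase_union_subset_frontier :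
    coneBase K z 1 ∪ coneBase K z (-1) ⊆ frontier K :=
  union_subset (fun _ h => h.2.1) fun _ h => h.2.1

theorem integral_frontier (hn : 1 ≤ n) (hK : IsCompact K) (hconv : Convex ℝ K)
    (hint : (interior K).Nonempty) {f : EuclideanSpace ℝ (Fin n) → ℝ} (hf : Integrable f) :
    (∀ᵐ x ∂(μHE[n - 1].restrict (frontier K)), ⟪z - x, outerNormal K x⟫_ℝ ≠ 0 →
      IntervalIntegrable (fun s : ℝ => f ((1 - s) • z + s • x) * s ^ (n - 1)) volume 0 1) ∧
    IntegrableOn (fun x => |⟪z - x, outerNormal K x⟫_ℝ| *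
      ∫ s in (0 : ℝ)..1, f ((1 - s) • z + s • x) * s ^ (n - 1)) (frontier K) μHE[n - 1] ∧
    ∫ x in frontier K, |⟪z - x, outerNormal K x⟫_ℝ| *
      (∫ s in (0 : ℝ)..1, f ((1 - s) • z + s • x) * s ^ (n - 1)) ∂μHE[n - 1] =
      (∫ y in convexHull ℝ (insert z K), f y) + ∫ y in convexHull ℝ (insert z K) \ K, f y := by
  have hE := fun τ => measurableSet_coneBase (z := z) (τ := τ) hK.isClosed
  obtain ⟨a1, i1, e1⟩ := integral_cone (z := z) (τ := 1) hK abs_one hf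
  obtain ⟨a2, i2, e2⟩ := integral_cone (z := z) (τ := -1) hK (by simp) hf
  have hzero : ∀ x ∈ frontier K \ (coneBase K z 1 ∪ coneBase K z (-1)),
      |⟪z - x, outerNormal K x⟫_ℝ| *
      ∫ s in (0 : ℝ)..1, f ((1 - s) • z + s • x) * s ^ (n - 1) = 0 := by
    rintro x ⟨hx, hx'⟩
    have : ⟪z - x, outerNormal K x⟫_ℝ = 0 := by
      by_contra h
      exact hx' (mem_coneBase_of_inner_ne_zero hK.isClosed hx h)
    rw [this, abs_zero, zero_mul]
  refine ⟨?_, ?_, ?_⟩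
  · rw [ae_restrict_iff' (hE _)] at a1 a2
    rw [ae_restrict_iff' isClosed_frontier.measurableSet]
    filter_upwards [a1, a2] with x h1 h2 hx hne
    exact (mem_coneBase_of_inner_ne_zero hK.isClosed hx hne).elim h1 h2
  · exact (i1.union i2).of_forall_sdiff_eq_zero isClosed_frontier.measurableSet hzero
  · rw [setIntegral_eq_of_subset_of_forall_sdiff_eq_zero isClosed_frontier.measurableSet
      coneBase_union_subset_frontier hzero,
      setIntegral_union disjoint_coneBase (hE _) i1 i2, e1, e2,
      setIntegral_congr_set (image_conePoint_ae_eq_convexHull hn hK hconv hint),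
      setIntegral_congr_set (image_conePoint_ae_eq_convexHull_diff hn hK hconv hint)]

theorem weightedVolume_real {U : Set (EuclideanSpace ℝ (Fin n))} (hU : IsOpen U)
    {φ : EuclideanSpace ℝ (Fin n) → ℝ} (hφ_pos : ∀ y ∈ U, 0 < φ y) (hφ_int : IntegrableOn φ U)
    (S : Set (EuclideanSpace ℝ (Fin n))) :
    (weightedVolume U φ).real S = ∫ y in S, U.indicator φ y := by
  rw [measureReal_def, weightedVolume, withDensity_apply', Measure.restrict_restrict' hU.measurableSet,
    setIntegral_indicator hU.measurableSet, integral_eq_lintegral_of_nonneg_ae]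
  · refine ae_restrict_of_ae_restrict_of_subset inter_subset_right ?_
    filter_upwards [ae_restrict_mem hU.measurableSet] with y hy using (hφ_pos y hy).le
  · exact (hφ_int.mono_set inter_subset_right).1

theorem continuous_integral_convexHull_insert (hK : IsCompact K) (hconv : Convex ℝ K)
    (hint : (interior K).Nonempty) {f : EuclideanSpace ℝ (Fin n) → ℝ} (hf : Integrable f) :
    Continuous fun z => ∫ y in convexHull ℝ (insert z K), f y := by
  have hm : ∀ z, NullMeasurableSet (convexHull ℝ (insert z K)) volume := fun z =>
    (convex_convexHull ℝ _).nullMeasurableSet volume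
  simp_rw [← integral_indicator₀ (hm _)]
  refine continuous_iff_continuousAt.2 fun z₀ => ?_
  refine tendsto_integral_filter_of_dominated_convergence (fun y => ‖f y‖)
    (Eventually.of_forall fun z => hf.1.indicator₀ (hm z))
    (Eventually.of_forall fun z => Eventually.of_forall fun y => norm_indicator_le_norm_self _ _)
    hf.norm ?_
  have h0 : ∀ᵐ y ∂(volume : Measure (EuclideanSpace ℝ (Fin n))),
      y ∉ frontier (convexHull ℝ (insert z₀ K)) :=
    measure_eq_zero_iff_ae_notMem.1 ((convex_convexHull ℝ _).addHaar_frontier volume)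
  filter_upwards [h0] with y hy
  refine tendsto_const_nhds.congr' ?_
  filter_upwards [eventually_mem_convexHull_insert_iff hK hconv hint hy] with z hz
  by_cases h : y ∈ convexHull ℝ (insert z₀ K)
  · rw [indicator_of_mem h, indicator_of_mem (hz.2 h)]
  · rw [indicator_of_notMem h, indicator_of_notMem fun h' => h (hz.1 h')]

end Integration

theorem mainTheorem5 (n : ℕ) (hn : 1 ≤ n)
    (K : ConvexBody (EuclideanSpace ℝ (Fin n)))
    (hK : (interior (K : Set (EuclideanSpace ℝ (Fin n)))).Nonempty)
    (U : Set (EuclideanSpace ℝ (Fin n))) (hU : IsOpen U)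
    (hKU : (K : Set (EuclideanSpace ℝ (Fin n))) ⊆ U)
    (φ : EuclideanSpace ℝ (Fin n) → ℝ) (hφ_pos : ∀ y ∈ U, 0 < φ y)
    (hφ_cont : ContinuousOn φ U) (hφ_int : IntegrableOn φ U) :
    (∀ z : EuclideanSpace ℝ (Fin n),
      (∀ᵐ x ∂((μHE[n - 1] : Measure (EuclideanSpace ℝ (Fin n))).restrict (frontier K)),
        ⟪z - x, outerNormal K x⟫_ℝ ≠ 0 →
          IntervalIntegrable
            (fun s : ℝ => U.indicator φ ((1 - s) • z + s • x) * s ^ (n - 1)) volume 0 1) ∧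
      IntegrableOn (fun x => |⟪z - x, outerNormal K x⟫_ℝ| * segmentIntegral U φ z x)
        (frontier K) μHE[n - 1] ∧
      illuminationFunctional U φ K z =
        -(1 / 2) * (weightedVolume U φ).real K +
          (1 / 2) * ∫ x in frontier (K : Set (EuclideanSpace ℝ (Fin n))),
            |⟪z - x, outerNormal K x⟫_ℝ| * segmentIntegral U φ z x ∂μHE[n - 1]) ∧
    Continuous (illuminationFunctional U φ K) := by
  have hf : Integrable (U.indicator φ) := (integrable_indicator_iff hU.measurableSet).2 hφ_int
  have hdiff : ∀ z, ∫ y in convexHull ℝ (insert z (K : Set _)) \ K, U.indicator φ y =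
      (∫ y in convexHull ℝ (insert z (K : Set _)), U.indicator φ y) -
        ∫ y in (K : Set _), U.indicator φ y := fun z =>
    setIntegral_sdiff K.isClosed.measurableSet hf.integrableOn
      ((subset_insert _ _).trans (subset_convexHull ℝ _))
  constructor
  · intro z
    obtain ⟨h1, h2, h3⟩ := integral_frontier (z := z) hn K.isCompact K.convex hK hf
    refine ⟨h1, h2, ?_⟩
    unfold segmentIntegral illuminationFunctional
    -- As `K ⊆ [z, K]`, the two integrals in `h3` sum to the volume of `K` plus twice that of `[z,
    -- K] \ K`.
    rw [h3, weightedVolume_real hU hφ_pos hφ_int, weightedVolume_real hU hφ_pos hφ_int, hdiff]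
    ring
  · unfold illuminationFunctional
    simp_rw [weightedVolume_real hU hφ_pos hφ_int, hdiff]
    exact (continuous_integral_convexHull_insert K.isCompact K.convex hK hf).sub continuous_const
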